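/- Let $d\ge 1$, let $\mathbb M$ be a Polish space with its Borel $\sigma$-algebra, and let $X_M=\sum_n\delta_{(X_n,M_n)}$ be a stationary simple marked point process on $\mathbb R^d$ with marks in $\mathbb M$, defined on a probability space $(\Omega,\mathcal A,\mathbb P)$: a random counting measure on $\mathbb R^d\times\mathbb M$ with pairwise distinct locations $X_n$, finitely many of them in each bounded set, whose law is invariant under all shifts $\sum_n\delta_{(X_n,M_n)}\mapsto\sum_n\delta_{(X_n-x,M_n)}$, $x\in\mathbb R^d$. Let $\lambda=\mathbb E X_M([0,1)^d\times\mathbb M)$ be its intensity and assume $\lambda>0$. For $B\in\mathcal B(\mathbb R^d)$ let $\mathcal A_{X_M}(B)$ be the $\sigma$-algebra generated by the restriction of $X_M$ to $B\times\mathbb M$, and for sub-$\sigma$-algebras $\mathcal A_1,\mathcal A_2$ of $\mathcal A$ put $$\beta(\mathcal A_1,\mathcal A_2)=\tfrac12\sup\sum_{i,j}\bigl|\mathbb P(A_i\cap A_j')-\mathbb P(A_i)\mathbb P(A_j')\bigr|,$$ the supremum being over all finite partitions $\{A_i\}$, $\{A'_j\}$ of $\Omega$ with $A_i\in\mathcal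 A_1$, $A'_j\in\mathcal A_2$. Let $\beta^*:[\tfrac12,\infty)\to[0,\infty)$ be a non-increasing function such that, with $K_a=[-a,a]^d$, $$\beta\bigl(\mathcal A_{X_M}(K_a),\mathcal A_{X_M}(\mathbb R^d\setminus K_{a+b})\bigr)\le\beta^*(b)\qquad\text{for } \tfrac12\le a\le b .$$ Suppose that for some $\delta>0$ $$\mathbb E\bigl(X_M([0,1]^d\times\mathbb M)\bigr)^{2+\delta}<\infty\qquad\text{and}\qquad\int_1^\infty r^{d-1}\beta^*(r)^{\delta/(2+\delta)}\,dr<\infty .$$ Let $\alpha^{(2)}_{X_M}(A)=\mathbb E\sum_{i\ne j}\mathbf 1_A\bigl((X_i,M_i),(X_j,M_j)\bigr)$ be the second factorial moment measure of $X_M$, and let $\alpha^{(2)}_X$ be that of the unmarked process, i.e. its image under $((x,u),(y,v))\mapsto(x,y)$. Then the following hold. (0) There is a unique locally finite measure $\alpha^{(2)}_{X,red}$ on $\mathbb R^d$ (the reduced second factorial moment measure) with $\alpha_X^{(2)}(B_1\times B_2)=\lambda\int_{B_1}\alpha_{X,red}^{(2)}(B_2-x)\,dx$ for all bounded Borel sets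 $B_1,B_2$. There is a stochastic kernel $P_M^{x_1,x_2}$ from $(\mathbb R^d)^2$ to $\mathbb M^2$ (a two-point Palm mark distribution) with $P_M^{x_1,x_2}=P_M^{\mathbf o,x_2-x_1}$ for $x_1\neq x_2$ and $$\alpha^{(2)}_{X_M}\bigl((B_1\times C_1)\times(B_2\times C_2)\bigr)=\int_{B_1\times B_2}P_M^{x_1,x_2}(C_1\times C_2)\,\alpha_X^{(2)}(d(x_1,x_2))$$ for all Borel sets $B_1,B_2\subseteq\mathbb R^d$, $C_1,C_2\subseteq\mathbb M$. (1) The reduced covariance measure $\gamma^{(2)}_{X,red}$, given by $\gamma^{(2)}_{X,red}(B)=\alpha^{(2)}_{X,red}(B)-\lambda|B|$ for bounded Borel sets $B$, has finite total variation on $\mathbb R^d$: it has a Jordan decomposition $\gamma^{(2)}_{X,red}=\gamma^+-\gamma^-$ into mutually singular measures, and $|\gamma^{(2)}_{X,red}|(\mathbb R^d)=\gamma^+(\mathbb R^d)+\gamma^-(\mathbb R^d)<\infty$. (2) With the Palm mark distribution $P_M^{\mathbf o}(C)=\lambda^{-1}\,\mathbb E X_M([0,1)^d\times C)$, for every kernel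 $P_M^{x_1,x_2}$ as in (0) and all Borel sets $C_1,C_2\subseteq\mathbb M$, $$\int_{\mathbb R^d}\bigl|P_M^{\mathbf o,x}(C_1\times C_2)-P_M^{\mathbf o}(C_1)P_M^{\mathbf o}(C_2)\bigr|\,\alpha^{(2)}_{X,red}(dx)<\infty .$$ -/

import Mathlib

open MeasureTheory ProbabilityTheory Set
open scoped ENNReal

namespace MPP

noncomputable section

/-- `ℝᵈ` with the Euclidean norm and Lebesgue measure. -/
abbrev Space (d : ℕ) : Type := EuclideanSpace ℝ (Fin d)

/-- The half-open unit cube `[0,1)ᵈ`. -/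
def unitCube (d : ℕ) : Set (Space d) := {x | ∀ i, x i ∈ Ico (0 : ℝ) 1}

/-- The closed unit cube `[0,1]ᵈ`. -/
def closedUnitCube (d : ℕ) : Set (Space d) := {x | ∀ i, x i ∈ Icc (0 : ℝ) 1}

/-- The cube `K_a = [-a,a]ᵈ`. -/
def symCube (d : ℕ) (a : ℝ) : Set (Space d) := {x | ∀ i, x i ∈ Icc (-a) a}

section Configurations

variable {d : ℕ} {M : Type*} [MeasurableSpace M]

/-- `φ = ∑ₙ δ_{(xₙ, mₙ)}` is a simple, locally finite counting measure on `ℝᵈ × M`: finitely many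
atoms lie over each bounded set of locations, and no two atoms share their location. -/
def IsSimpleConfiguration (φ : Measure (Space d × M)) : Prop :=
  ∃ S : Set (Space d × M),
    (∀ B : Set (Space d), Bornology.IsBounded B → (S ∩ B ×ˢ univ).Finite) ∧
    InjOn Prod.fst S ∧
    φ = Measure.sum (fun p : S => Measure.dirac (p : Space d × M))

/-- The shifted configuration `∑ₙ δ_{(xₙ - x, mₙ)}`. -/
def shift (x : Space d) (φ : Measure (Space d × M)) : Measure (Space d × M) :=
  φ.map (fun p => (p.1 - x, p.2))

/-- The ordered pairs of distinct atoms of `φ`. -/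
def distinctAtomPairs (φ : Measure (Space d × M)) : Set ((Space d × M) × (Space d × M)) :=
  {pq | φ {pq.1} ≠ 0 ∧ φ {pq.2} ≠ 0 ∧ pq.1 ≠ pq.2}

/-- The measure `∑_{n₁ ≠ n₂} δ_{((x_{n₁}, m_{n₁}), (x_{n₂}, m_{n₂}))}` on pairs. -/
def factorialSquare (φ : Measure (Space d × M)) : Measure ((Space d × M) × (Space d × M)) :=
  Measure.sum (fun pq : distinctAtomPairs φ =>
    Measure.dirac (pq : (Space d × M) × (Space d × M)))

end Configurations

section Processes

variable {d : ℕ} {M : Type*} [MeasurableSpace M] {Ω : Type*} [MeasurableSpace Ω]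

/-- A simple marked point process: a random simple configuration. The space of measures carries
the σ-algebra generated by the evaluations `φ ↦ φ(A)`. -/
structure IsMarkedPointProcess (X : Ω → Measure (Space d × M)) : Prop where
  measurable : Measurable X
  simple : ∀ ω, IsSimpleConfiguration (X ω)

/-- The law of the process is invariant under all shifts of the locations. -/
def IsStationary (P : Measure Ω) (X : Ω → Measure (Space d × M)) : Prop :=
  ∀ x : Space d, P.map (fun ω => shift x (X ω)) = P.map X

/-- The intensity `λ = 𝔼 X([0,1)ᵈ × M)`. -/
def intensity (P : Measure Ω) (X : Ω → Measure (Space d × M)) : ℝ≥0∞ :=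
  ∫⁻ ω, X ω (unitCube d ×ˢ univ) ∂P

/-- The Palm mark distribution `C ↦ λ⁻¹ 𝔼 X([0,1)ᵈ × C)`. -/
def palmMark (P : Measure Ω) (X : Ω → Measure (Space d × M)) (C : Set M) : ℝ≥0∞ :=
  (intensity P X)⁻¹ * ∫⁻ ω, X ω (unitCube d ×ˢ C) ∂P

/-- The second factorial moment measure of the marked point process,
`A ↦ 𝔼 ∑_{n₁ ≠ n₂} 1_A((X_{n₁}, M_{n₁}), (X_{n₂}, M_{n₂}))`. -/
def factorialMoment₂ (P : Measure Ω) (X : Ω → Measure (Space d × M)) :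
    Measure ((Space d × M) × (Space d × M)) :=
  P.bind (fun ω => factorialSquare (X ω))

/-- The second factorial moment measure of the unmarked point process. -/
def groundFactorialMoment₂ (P : Measure Ω) (X : Ω → Measure (Space d × M)) :
    Measure (Space d × Space d) :=
  (factorialMoment₂ P X).map (fun pq => (pq.1.1, pq.2.1))

/-- `ν` is the reduced second factorial moment measure: it is locally finite and
`α⁽²⁾(B₁ × B₂) = λ ∫_{B₁} ν(B₂ - x) dx` for bounded Borel sets `B₁, B₂`. -/
structure IsReducedFactorialMoment₂ (P : Measure Ω) (X : Ω → Measure (Space d × M))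
    (ν : Measure (Space d)) : Prop where
  locallyFinite : IsLocallyFiniteMeasure ν
  disintegration : ∀ B₁ B₂ : Set (Space d), MeasurableSet B₁ → MeasurableSet B₂ →
    Bornology.IsBounded B₁ → Bornology.IsBounded B₂ →
    groundFactorialMoment₂ P X (B₁ ×ˢ B₂) =
      intensity P X * ∫⁻ x in B₁, ν {y | y + x ∈ B₂}

/-- The reduced covariance measure `γ_red(B) = ν(B) - λ |B|`, evaluated at bounded Borel sets;
here `ν` is the reduced second factorial moment measure. -/
def reducedCovariance (P : Measure Ω) (X : Ω → Measure (Space d × M)) (ν : Measure (Space d))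
    (B : Set (Space d)) : ℝ :=
  (ν B).toReal - (intensity P X).toReal * (volume B).toReal

/-- `Q (x₁, x₂)` is (a version of) the two-point Palm mark distribution: a stochastic kernel that
is a density of the marked with respect to the unmarked second factorial moment measure, and that
depends on distinct points only through their difference. -/
structure IsTwoPointPalmMark (P : Measure Ω) (X : Ω → Measure (Space d × M))
    (Q : Kernel (Space d × Space d) (M × M)) : Prop where
  markov : IsMarkovKernel Q
  density : ∀ (B₁ B₂ : Set (Space d)) (C₁ C₂ : Set M), MeasurableSet B₁ → MeasurableSet B₂ →
    MeasurableSet C₁ → MeasurableSet C₂ →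
    factorialMoment₂ P X ((B₁ ×ˢ C₁) ×ˢ (B₂ ×ˢ C₂)) =
      ∫⁻ x in B₁ ×ˢ B₂, Q x (C₁ ×ˢ C₂) ∂(groundFactorialMoment₂ P X)
  shift_invariant : ∀ x₁ x₂ : Space d, x₁ ≠ x₂ → Q (x₁, x₂) = Q (0, x₂ - x₁)

/-- The σ-algebra generated by the restriction of the process to `B × M`. -/
abbrev localSigma (X : Ω → Measure (Space d × M)) (B : Set (Space d)) : MeasurableSpace Ω :=
  MeasurableSpace.comap (fun ω => (X ω).restrict (B ×ˢ univ)) inferInstance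

end Processes

/-- `μp` and `μm` form the Jordan decomposition of the signed set function `γ`, which is given
on bounded Borel sets. -/
structure IsJordanDecomposition {d : ℕ} (γ : Set (Space d) → ℝ) (μp μm : Measure (Space d)) :
    Prop where
  singular : μp ⟂ₘ μm
  finite_pos : ∀ B : Set (Space d), Bornology.IsBounded B → μp B < ∞
  finite_neg : ∀ B : Set (Space d), Bornology.IsBounded B → μm B < ∞
  eq_sub : ∀ B : Set (Space d), MeasurableSet B → Bornology.IsBounded B →
    γ B = (μp B).toReal - (μm B).toReal

/-- `A₀, …, A_{n-1}` is a finite partition of `Ω` into sets of the σ-algebra `𝒜`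
(empty pieces are harmless and allowed). -/
def IsPartition {Ω : Type*} (𝒜 : MeasurableSpace Ω) {n : ℕ} (A : Fin n → Set Ω) : Prop :=
  (∀ i, MeasurableSet[𝒜] (A i)) ∧ Pairwise (fun i j => Disjoint (A i) (A j)) ∧ ⋃ i, A i = univ

/-- The `β`-mixing (absolute regularity) coefficient
`½ sup ∑_{i,j} |P(Aᵢ ∩ A'ⱼ) - P(Aᵢ) P(A'ⱼ)|` over finite partitions from `𝒜` and `ℬ`. -/
def betaCoeff {Ω : Type*} [MeasurableSpace Ω] (P : Measure Ω) (𝒜 ℬ : MeasurableSpace Ω) :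
    ℝ≥0∞ :=
  2⁻¹ * ⨆ (m : ℕ) (n : ℕ) (A : Fin m → Set Ω) (A' : Fin n → Set Ω)
    (_ : IsPartition 𝒜 A) (_ : IsPartition ℬ A'),
    ∑ i, ∑ j, ENNReal.ofReal |P.real (A i ∩ A' j) - P.real (A i) * P.real (A' j)|

/-- `βs : [1/2, ∞) → [0, ∞)` is a (first) `β`-mixing rate of the process: it is non-increasing and
`β(𝒜(K_a), 𝒜(K_{a+b}ᶜ)) ≤ βs(b)` for `1/2 ≤ a ≤ b`. -/
structure IsBetaRate {d : ℕ} {M : Type*} [MeasurableSpace M] {Ω : Type*} [MeasurableSpace Ω]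
    (P : Measure Ω) (X : Ω → Measure (Space d × M)) (βs : ℝ → ℝ) : Prop where
  antitone : AntitoneOn βs (Ici (1 / 2))
  nonneg : ∀ r, 1 / 2 ≤ r → 0 ≤ βs r
  bound : ∀ a b : ℝ, 1 / 2 ≤ a → a ≤ b →
    betaCoeff P (localSigma X (symCube d a)) (localSigma X (symCube d (a + b))ᶜ) ≤
      ENNReal.ofReal (βs b)

end

end MPP

/-! In the coordinates (first location, displacement, two marks), stationarity makes the second
factorial moment measure invariant under translations of the first location alone. It is therefore
Lebesgue measure times `reducedPairs`, a measure of displacement and marks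
(`eq_volume_prod_of_shift_invariant`). The displacement marginal of `reducedPairs` is `λ` times the
reduced factorial moment measure. Cancelling the Lebesgue factor gives uniqueness, and
disintegrating along the displacement gives a two-point Palm mark kernel that depends on `x₂ - x₁`
only.

Both finiteness claims rest on one estimate, `exists_reducedPairs_bound`: for fixed `C₁`, `C₂` the
masses `reducedPairs (B × C₁ × C₂)` and `θ(C₁) θ(C₂) |B|`, with `θ` the mean measure of the marks in
the unit cube, differ by at most a constant uniform in the Borel set `B`. Both may be infinite, so
the estimate is a pair of inequalities in `[0,∞]`.

To prove it, cut `B` along the lattice cubes. A displacement in a far cube `k` separates the two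
points by a gap of about `‖k‖`, so the pair count is a functional of the process inside a cube and
far outside it. The joint law of these two restrictions differs from the product of their laws by at
most `2β` on every measurable set (`joint_prod_measure_le`). Hölder's inequality with exponents
`(2+δ)/2` and `(2+δ)/δ` turns this into an error of order `β*(‖k‖-3)^(δ/(2+δ))`. The sum of these
errors over the lattice is dominated by the assumed radial integral, and the finitely many near
cubes have finite mass.

With `C₁ = C₂ = M` the estimate bounds the covariance measure as a set function, and the positive
parts of a difference of densities are its Jordan decomposition. For the marks, the same case
replaces `|B|` by the reduced moment measure in the estimate for `C₁`, `C₂`. The integral of the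
difference of the densities is then bounded over all Borel sets, in particular over the sets where
the difference has one sign, and this is an `L¹` bound. -/

namespace MPP

/-! ### Measure-theoretic tools: set-wise comparison, s-finite kernels, disintegration. -/

/-- If `μ` exceeds `ν` by at most `b` on every measurable set, then the integral of a nonnegative
function against `μ` exceeds the one against `ν` by at most a Hölder-type bound. -/
theorem lintegral_le_add_of_measure_le_add {α : Type*} [MeasurableSpace α] (μ ν : Measure α)
    [IsFiniteMeasure μ] [IsFiniteMeasure ν] {b : ℝ≥0∞}
    (hb : ∀ s, MeasurableSet s → μ s ≤ ν s + b) {p q : ℝ} (hpq : p.HolderConjugate q)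
    {h : α → ℝ≥0∞} (hh : Measurable h) :
    ∫⁻ x, h x ∂μ ≤ ∫⁻ x, h x ∂ν + (∫⁻ x, h x ^ p ∂μ) ^ (1 / p) * b ^ (1 / q) := by
  -- Only the Hahn set `s`, where `μ` dominates, contributes to the excess. The excess `e` there has
  -- mass at most `b` and lies below `μ`, so Hölder against the constant `1` bounds the integral of
  -- `h`.
  obtain ⟨s, hs⟩ := exists_isHahnDecomposition ν μ
  have hsm := hs.measurableSet
  set e := μ.restrict s - ν.restrict s with he
  have hadd : e + ν.restrict s = μ.restrict s := Measure.sub_add_cancel_of_le hs.le_on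
  have heμ : e ≤ μ := Measure.sub_le.trans Measure.restrict_le_self
  have heb : e univ ≤ b := by
    rw [he, Measure.sub_apply .univ hs.le_on]
    simpa [tsub_le_iff_left, add_comm] using hb s hsm
  have h1 : ∫⁻ x, h x ∂e ≤ (∫⁻ x, h x ^ p ∂μ) ^ (1 / p) * b ^ (1 / q) := by
    have := ENNReal.lintegral_mul_le_Lp_mul_Lq e hpq hh.aemeasurable
      (aemeasurable_const (b := (1 : ℝ≥0∞)))
    simp only [Pi.mul_apply, mul_one, ENNReal.one_rpow, lintegral_const, one_mul] at this
    refine this.trans ?_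
    have := hpq.nonneg
    have := hpq.symm.nonneg
    gcongr
  calc ∫⁻ x, h x ∂μ = ∫⁻ x in s, h x ∂μ + ∫⁻ x in sᶜ, h x ∂μ := (lintegral_add_compl _ hsm).symm
    _ ≤ (∫⁻ x, h x ∂e + ∫⁻ x in s, h x ∂ν) + ∫⁻ x in sᶜ, h x ∂ν := by
        rw [← hadd, lintegral_add_measure]
        exact add_le_add_right (lintegral_mono' hs.ge_on_compl le_rfl) _
    _ = ∫⁻ x, h x ∂e + ∫⁻ x, h x ∂ν := by rw [add_assoc, lintegral_add_compl _ hsm]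
    _ ≤ _ := by rw [add_comm]; gcongr

/-- If the integrals of `f` exceed those of `g` by at most `c` on every measurable set, and `g` is
integrable over an exhausting sequence, then the excess `f - g` has integral at most `c`. -/
theorem lintegral_sub_le_of_setLIntegral_le_add {α : Type*} [MeasurableSpace α] (τ : Measure α)
    {f g : α → ℝ≥0∞} (hf : Measurable f) (hg : Measurable g) {c : ℝ≥0∞} {S : ℕ → Set α}
    (hS : ∀ n, MeasurableSet (S n)) (hmono : Monotone S) (hcov : ⋃ n, S n = univ)
    (hfin : ∀ n, ∫⁻ x in S n, g x ∂τ ≠ ∞)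
    (h : ∀ s, MeasurableSet s → (∃ n, s ⊆ S n) → ∫⁻ x in s, f x ∂τ ≤ ∫⁻ x in s, g x ∂τ + c) :
    ∫⁻ x, (f x - g x) ∂τ ≤ c := by
  rw [← setLIntegral_univ, ← hcov, setLIntegral_iUnion_of_directed _ hmono.directed_le]
  refine iSup_le fun n => ?_
  -- The excess is one integral over `H`. Intersecting with `S n` keeps the integral of `g` finite,
  -- so that it can be subtracted.
  set H := {x | g x < f x} with hH
  have hHm : MeasurableSet H := measurableSet_lt hg hf
  have hgn : ∫⁻ x in S n ∩ H, g x ∂τ ≠ ∞ :=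
    ne_top_of_le_ne_top (hfin n) (lintegral_mono_set inter_subset_left)
  calc ∫⁻ x in S n, (f x - g x) ∂τ = ∫⁻ x in S n ∩ H, (f x - g x) ∂τ := by
        rw [← lintegral_inter_add_sdiff (fun x => f x - g x) (S n) hHm]
        rw [setLIntegral_congr_fun (g := fun _ => 0) ((hS n).diff hHm) (fun x hx => ?_)]
        · simp
        · exact tsub_eq_zero_of_le (not_lt.1 hx.2)
    _ = ∫⁻ x in S n ∩ H, f x ∂τ - ∫⁻ x in S n ∩ H, g x ∂τ := by
        refine lintegral_sub hg hgn ?_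
        filter_upwards [ae_restrict_mem ((hS n).inter hHm)] with x hx using (le_of_lt hx.2)
    _ ≤ c := by
        rw [tsub_le_iff_left]
        exact h _ ((hS n).inter hHm) ⟨n, inter_subset_left⟩

/-- A kernel all of whose measures are finite is s-finite. -/
theorem isSFiniteKernel_of_forall_ne_top {α β : Type*} [MeasurableSpace α] [MeasurableSpace β]
    (κ : Kernel α β) (h : ∀ a, κ a univ ≠ ∞) : IsSFiniteKernel κ := by
  classical
  have hm : ∀ n : ℕ, MeasurableSet {a | ⌊(κ a univ).toReal⌋₊ = n} := fun n =>
    (Nat.measurable_floor.comp (κ.measurable_coe .univ).ennreal_toReal) (measurableSet_singleton n)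
  -- The base space is cut by the integer part of the total mass; on the `n`-th piece the mass is at
  -- most `n + 1`.
  refine ⟨⟨fun n => Kernel.piecewise (hm n) κ 0, fun n => ⟨⟨n + 1, by finiteness, fun a => ?_⟩⟩, ?_⟩⟩
  · rw [Kernel.piecewise_apply]
    split_ifs with ha
    · rw [← ENNReal.ofReal_toReal (h a), ← Nat.cast_add_one, ← ENNReal.ofReal_natCast]
      refine ENNReal.ofReal_le_ofReal ?_
      have := (Nat.lt_floor_add_one (κ a univ).toReal).le
      rw [ha] at this
      exact_mod_cast this
    · simp
  · ext a s hs
    rw [Kernel.sum_apply' _ _ hs, tsum_eq_single ⌊(κ a univ).toReal⌋₊]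
    · rw [Kernel.piecewise_apply, if_pos (by rfl)]
    · intro n hn
      rw [Kernel.piecewise_apply, if_neg]
      · simp
      · exact fun h => hn h.symm

/-- A measure with σ-finite first marginal disintegrates along a Markov kernel. -/
theorem exists_isMarkovKernel_prod_eq {α T : Type*} [MeasurableSpace α] [MeasurableSpace T]
    [StandardBorelSpace T] [Nonempty T] (ρ : Measure (α × T)) [SigmaFinite (ρ.map Prod.fst)] :
    ∃ K : Kernel α T, IsMarkovKernel K ∧ ∀ B D, MeasurableSet B → MeasurableSet D →
      ρ (B ×ˢ D) = ∫⁻ x in B, K x D ∂(ρ.map Prod.fst) := by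
  -- A positive integrable weight makes `ρ` finite. It depends on the first coordinate only, so it
  -- cancels from the conditional distributions.
  obtain ⟨g, gpos, gm, gint⟩ := exists_pos_lintegral_lt_of_sigmaFinite (ρ.map Prod.fst) one_ne_zero
  have gm' : Measurable fun z : α × T => (g z.1 : ℝ≥0∞) := by fun_prop
  set ρ' := ρ.withDensity fun z => g z.1 with hρ'
  have hfst : ρ'.fst = (ρ.map Prod.fst).withDensity fun x => g x := by
    ext s hs
    rw [Measure.fst_apply hs, withDensity_apply _ (measurable_fst hs), withDensity_apply _ hs,
      setLIntegral_map hs (by fun_prop) measurable_fst]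
  have : IsFiniteMeasure ρ' := ⟨by
    rw [← Measure.fst_univ, hfst, withDensity_apply _ .univ, setLIntegral_univ]
    exact gint.trans ENNReal.one_lt_top⟩
  refine ⟨ρ'.condKernel, inferInstance, fun B D hB hD => ?_⟩
  have hinv : ∀ x : α, (g x : ℝ≥0∞) * (g x : ℝ≥0∞)⁻¹ = 1 := fun x =>
    ENNReal.mul_inv_cancel (by simpa using (gpos x).ne') ENNReal.coe_ne_top
  have hinvm : Measurable fun x : α => (g x : ℝ≥0∞)⁻¹ := by fun_prop
  have h1 : ρ (B ×ˢ D) = ∫⁻ z in B ×ˢ D, (g z.1 : ℝ≥0∞)⁻¹ ∂ρ' := by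
    rw [hρ', setLIntegral_withDensity_eq_setLIntegral_mul _ gm' (by fun_prop) (hB.prod hD)]
    simp [hinv]
  rw [h1]
  nth_rw 1 [← ρ'.disintegrate ρ'.condKernel]
  rw [Measure.setLIntegral_compProd (by fun_prop) hB hD, hfst,
    setLIntegral_withDensity_eq_setLIntegral_mul _ (by fun_prop) ?_ hB]
  · refine lintegral_congr fun x => ?_
    simp only [lintegral_const, Pi.mul_apply, Measure.restrict_apply_univ]
    rw [← mul_assoc, hinv, one_mul]
  · simp only [lintegral_const, Measure.restrict_apply_univ]
    exact hinvm.mul (Kernel.measurable_coe _ hD)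

/-! ### Lattice cubes. -/

/-- The half-open unit cube with lower corner `k`. -/
def cubeAt {d : ℕ} (k : Fin d → ℤ) : Set (Space d) := {x | ∀ i, x i - k i ∈ Ico (0 : ℝ) 1}

theorem measurableSet_forall_coord {d : ℕ} {s : Fin d → Set ℝ} (hs : ∀ i, MeasurableSet (s i)) :
    MeasurableSet {x : Space d | ∀ i, x i ∈ s i} := by
  rw [ofPred_forall]
  exact MeasurableSet.iInter fun i => (by fun_prop : Measurable fun x : Space d => x i) (hs i)

theorem isBounded_of_forall_coord {d : ℕ} {s : Set (Space d)} (C : ℝ)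
    (hs : ∀ x ∈ s, ∀ i, |x i| ≤ C) : Bornology.IsBounded s := by
  have h : Bornology.IsBounded ((EuclideanSpace.equiv (Fin d) ℝ) '' s) := by
    refine (Metric.isBounded_closedBall (x := (0 : Fin d → ℝ)) (r := max C 0)).subset ?_
    rintro _ ⟨x, hx, rfl⟩
    rw [mem_closedBall_zero_iff, pi_norm_le_iff_of_nonneg (le_max_right _ _)]
    exact fun i => (hs x hx i).trans (le_max_left _ _)
  have := (EuclideanSpace.equiv (Fin d) ℝ).symm.lipschitz.isBounded_image h
  rw [image_image] at this
  simpa only [ContinuousLinearEquiv.symm_apply_apply, image_id'] using this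

theorem unitCube_eq_cubeAt (d : ℕ) : unitCube d = cubeAt 0 := by
  ext x; simp [unitCube, cubeAt]

theorem cubeAt_eq_forall_coord {d : ℕ} (k : Fin d → ℤ) :
    cubeAt k = {x : Space d | ∀ i, x i ∈ Ico (k i : ℝ) (k i + 1)} := by
  ext x
  simp only [cubeAt, mem_Ico, mem_ofPred_eq, sub_nonneg, sub_lt_iff_lt_add']

theorem measurableSet_cubeAt {d : ℕ} (k : Fin d → ℤ) : MeasurableSet (cubeAt k) := by
  rw [cubeAt_eq_forall_coord]
  exact measurableSet_forall_coord fun i => measurableSet_Ico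

theorem measurableSet_unitCube (d : ℕ) : MeasurableSet (unitCube d) := by
  rw [unitCube_eq_cubeAt]; exact measurableSet_cubeAt 0

theorem volume_cubeAt {d : ℕ} (k : Fin d → ℤ) : volume (cubeAt k) = 1 := by
  have h : cubeAt k = (WithLp.ofLp : Space d → Fin d → ℝ) ⁻¹'
      (univ.pi fun i => Ico (k i : ℝ) (k i + 1)) := by
    ext x; simp [cubeAt_eq_forall_coord]
  rw [h, (PiLp.volume_preserving_ofLp (Fin d)).measure_preimage
    (MeasurableSet.univ_pi fun i => measurableSet_Ico).nullMeasurableSet, Real.volume_pi_Ico]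
  simp

theorem volume_unitCube (d : ℕ) : volume (unitCube d) = 1 := by
  rw [unitCube_eq_cubeAt, volume_cubeAt]

theorem isBounded_cubeAt {d : ℕ} (k : Fin d → ℤ) : Bornology.IsBounded (cubeAt k) := by
  refine isBounded_of_forall_coord (∑ i, |(k i : ℝ)| + 1) fun x hx i => ?_
  have h1 := hx i
  have h2 : |(k i : ℝ)| ≤ ∑ i, |(k i : ℝ)| :=
    Finset.single_le_sum (f := fun i => |(k i : ℝ)|) (fun i _ => abs_nonneg _) (Finset.mem_univ i)
  have h3 : |x i| ≤ |x i - k i| + |(k i : ℝ)| := by simpa using abs_add_le (x i - k i) (k i)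
  have h4 : |x i - k i| ≤ 1 := by rw [abs_of_nonneg h1.1]; exact h1.2.le
  linarith

theorem isBounded_unitCube (d : ℕ) : Bornology.IsBounded (unitCube d) := by
  rw [unitCube_eq_cubeAt]; exact isBounded_cubeAt 0

theorem mem_cubeAt_floor {d : ℕ} (x : Space d) : x ∈ cubeAt fun i => ⌊x i⌋ := fun i =>
  ⟨Int.fract_nonneg (x i), Int.fract_lt_one (x i)⟩

theorem eq_floor_of_mem_cubeAt {d : ℕ} {k : Fin d → ℤ} {x : Space d} (hx : x ∈ cubeAt k) :
    k = fun i => ⌊x i⌋ := by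
  funext i
  have := hx i
  rw [eq_comm, Int.floor_eq_iff]
  constructor <;> linarith [this.1, this.2]

theorem iUnion_cubeAt (d : ℕ) : ⋃ k : Fin d → ℤ, cubeAt k = univ :=
  eq_univ_of_forall fun x => mem_iUnion.2 ⟨_, mem_cubeAt_floor x⟩

theorem pairwise_disjoint_cubeAt (d : ℕ) :
    Pairwise fun k l : Fin d → ℤ => Disjoint (cubeAt k) (cubeAt l) := fun _ _ hkl =>
  disjoint_left.2 fun _ hx hy => hkl ((eq_floor_of_mem_cubeAt hx).trans
    (eq_floor_of_mem_cubeAt hy).symm)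

/-! ### Splitting off and cancelling the Lebesgue factor. -/

/-- A shift-invariant measure on `ℝᵈ × T` that is finite over bounded sets along an exhaustion of
`T` is the product of Lebesgue measure and its restriction to the unit cube. -/
theorem eq_volume_prod_of_shift_invariant {d : ℕ} {T : Type*} [MeasurableSpace T]
    (ρ : Measure (Space d × T))
    (hinv : ∀ x : Space d, ρ.map (fun p => (p.1 - x, p.2)) = ρ)
    {D : ℕ → Set T} (hD : ∀ n, MeasurableSet (D n)) (hmono : Monotone D) (hcov : ⋃ n, D n = univ)
    (hfin : ∀ n B, Bornology.IsBounded B → ρ (B ×ˢ D n) ≠ ∞) :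
    SigmaFinite ((ρ.restrict (unitCube d ×ˢ univ)).map Prod.snd) ∧
      ρ = volume.prod ((ρ.restrict (unitCube d ×ˢ univ)).map Prod.snd) := by
  set κ := (ρ.restrict (unitCube d ×ˢ univ)).map Prod.snd with hκ
  have hκ_apply : ∀ E, MeasurableSet E → κ E = ρ (unitCube d ×ˢ E) := fun E hE => by
    rw [hκ, Measure.map_apply measurable_snd hE, Measure.restrict_apply (measurable_snd hE)]
    congr 1
    ext p; simp [and_comm]
  have hsf : SigmaFinite κ := ⟨⟨{
    set := D
    set_mem := fun _ => trivial
    finite := fun n => by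
      rw [hκ_apply _ (hD n)]
      exact (hfin n _ (isBounded_unitCube d)).lt_top
    spanning := hcov }⟩⟩
  refine ⟨hsf, (Measure.prod_eq fun B E hB hE => ?_).symm⟩
  -- For a fixed second factor of finite mass, `ρ` is a translation-invariant measure in the first,
  -- hence a multiple of Lebesgue measure. The unit cube, of volume one, reads off the factor.
  have key : ∀ n, ρ (B ×ˢ (E ∩ D n)) = volume B * κ (E ∩ D n) := fun n => by
    have hEn := hE.inter (hD n)
    set μ := (ρ.restrict (univ ×ˢ (E ∩ D n))).map Prod.fst with hμ
    have hμ_apply : ∀ A, MeasurableSet A → μ A = ρ (A ×ˢ (E ∩ D n)) := fun A hA => by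
      rw [hμ, Measure.map_apply measurable_fst hA, Measure.restrict_apply (measurable_fst hA)]
      congr 1
      ext p; simp
    have : IsFiniteMeasureOnCompacts μ := ⟨fun K hK => by
      rw [hμ_apply _ hK.measurableSet]
      exact (measure_mono (prod_mono_right inter_subset_right)).trans_lt
        (hfin n K hK.isBounded).lt_top⟩
    have : μ.IsAddLeftInvariant := ⟨fun x => by
      ext A hA
      rw [Measure.map_apply (measurable_const_add x) hA, hμ_apply _ hA,
        hμ_apply _ (measurable_const_add x hA)]
      conv_rhs => rw [← hinv (-x)]
      rw [Measure.map_apply (by fun_prop) (hA.prod hEn)]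
      congr 1
      ext p; simp [add_comm x]⟩
    have h := Measure.isAddLeftInvariant_eq_smul μ (volume : Measure (Space d))
    set c := Measure.addHaarScalarFactor μ (volume : Measure (Space d))
    have hc : κ (E ∩ D n) = c := by
      rw [hκ_apply _ hEn, ← hμ_apply _ (measurableSet_unitCube d), h]
      simp [volume_unitCube]
    rw [← hμ_apply _ hB, hc, h, mul_comm]
    simp
  have hmono' : Monotone fun n => E ∩ D n := fun m n h => inter_subset_inter_right _ (hmono h)
  have hE' : E = ⋃ n, E ∩ D n := by rw [← inter_iUnion, hcov, inter_univ]
  have h1 : ρ (B ×ˢ E) = ⨆ n, ρ (B ×ˢ (E ∩ D n)) := by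
    conv_lhs => rw [hE', prod_iUnion]
    exact Monotone.measure_iUnion fun m n h => prod_mono_right (hmono' h)
  have h2 : κ E = ⨆ n, κ (E ∩ D n) := by
    conv_lhs => rw [hE']
    exact hmono'.measure_iUnion
  rw [h1, h2, ENNReal.mul_iSup]
  exact iSup_congr key

/-- Left factor Lebesgue measure can be cancelled in products. -/
theorem eq_of_volume_prod_eq {d : ℕ} {T : Type*} [MeasurableSpace T] {κ₁ κ₂ : Measure T}
    [SFinite κ₁] [SFinite κ₂]
    (h : (volume : Measure (Space d)).prod κ₁ = (volume : Measure (Space d)).prod κ₂) :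
    κ₁ = κ₂ := by
  ext D hD
  have := congrArg (fun m => m (unitCube d ×ˢ D)) h
  simpa [Measure.prod_prod, volume_unitCube] using this

/-! ### From the `β`-coefficient to a bound on all measurable sets. -/

section Beta

variable {Y₁ Y₂ : Type*} [MeasurableSpace Y₁] [MeasurableSpace Y₂]

/-- Subsets of a product that are finite unions of cells of a measurable grid. -/
def gridSets (Y₁ Y₂ : Type*) [MeasurableSpace Y₁] [MeasurableSpace Y₂] : Set (Set (Y₁ × Y₂)) :=
  {S | ∃ (m n : ℕ) (f : Y₁ → Fin m) (g : Y₂ → Fin n) (I : Set (Fin m × Fin n)),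
    Measurable f ∧ Measurable g ∧ S = {y | (f y.1, g y.2) ∈ I}}

/-- Arbitrary finite label types allow pairs of labels, for common refinements, and Boolean labels,
for rectangles. -/
theorem mem_gridSets_of_finite {F G : Type*} [Finite F] [Finite G] [MeasurableSpace F]
    [MeasurableSpace G] [MeasurableSingletonClass F] [MeasurableSingletonClass G]
    {f : Y₁ → F} {g : Y₂ → G}
    (hf : Measurable f) (hg : Measurable g) (I : Set (F × G)) :
    {y : Y₁ × Y₂ | (f y.1, g y.2) ∈ I} ∈ gridSets Y₁ Y₂ := by
  obtain ⟨m, ⟨e⟩⟩ := Finite.exists_equiv_fin F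
  obtain ⟨n, ⟨e'⟩⟩ := Finite.exists_equiv_fin G
  refine ⟨m, n, e ∘ f, e' ∘ g, {ij | (e.symm ij.1, e'.symm ij.2) ∈ I},
    (measurable_of_finite e).comp hf, (measurable_of_finite e').comp hg, ?_⟩
  ext y; simp

/-- Two grids have a common refinement, labelled by pairs. Being an algebra that generates the
product σ-algebra, the grid sets approximate every measurable set in a finite measure; on grid sets
the partitions in `betaCoeff` apply directly. -/
theorem isSetAlgebra_gridSets : IsSetAlgebra (gridSets Y₁ Y₂) where
  empty_mem := ⟨1, 1, fun _ => 0, fun _ => 0, ∅, measurable_const, measurable_const, by simp⟩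
  compl_mem := by
    rintro _ ⟨m, n, f, g, I, hf, hg, rfl⟩
    exact ⟨m, n, f, g, Iᶜ, hf, hg, rfl⟩
  union_mem := by
    rintro _ _ ⟨m, n, f, g, I, hf, hg, rfl⟩ ⟨m', n', f', g', I', hf', hg', rfl⟩
    convert mem_gridSets_of_finite (hf.prodMk hf') (hg.prodMk hg')
      {z | (z.1.1, z.2.1) ∈ I ∨ (z.1.2, z.2.2) ∈ I'} using 1
    ext y; simp

theorem measurableSet_of_mem_gridSets {S : Set (Y₁ × Y₂)} (hS : S ∈ gridSets Y₁ Y₂) :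
    MeasurableSet S := by
  obtain ⟨m, n, f, g, I, hf, hg, rfl⟩ := hS
  exact ((hf.comp measurable_fst).prodMk (hg.comp measurable_snd)) I.toFinite.measurableSet

theorem generateFrom_gridSets :
    (inferInstance : MeasurableSpace (Y₁ × Y₂)) =
      MeasurableSpace.generateFrom (gridSets Y₁ Y₂) := by
  classical
  refine le_antisymm ?_ (MeasurableSpace.generateFrom_le fun S => measurableSet_of_mem_gridSets)
  rw [← generateFrom_prod]
  refine MeasurableSpace.generateFrom_mono ?_
  rintro _ ⟨A, hA, B, hB, rfl⟩
  -- A rectangle is the cell `(true, true)` of the grid cut out by membership in its two sides.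
  convert mem_gridSets_of_finite (f := fun y => decide (y ∈ A)) (g := fun y => decide (y ∈ B))
    (measurable_to_bool (by simpa [preimage] using hA))
    (measurable_to_bool (by simpa [preimage] using hB)) {(true, true)} using 1
  ext y; simp

variable {Ω : Type*} [MeasurableSpace Ω] (P : Measure Ω) [IsProbabilityMeasure P]

/-- The `β`-mixing coefficient controls the deviation of the joint law from the product of the
marginals on every measurable set. -/
theorem joint_prod_measure_le {U : Ω → Y₁} {V : Ω → Y₂} (hU : Measurable U) (hV : Measurable V)
    {S : Set (Y₁ × Y₂)} (hS : MeasurableSet S) {b : ℝ≥0∞}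
    (hb : betaCoeff P (MeasurableSpace.comap U inferInstance)
      (MeasurableSpace.comap V inferInstance) ≤ b) :
    P.map (fun ω => (U ω, V ω)) S ≤ ((P.map U).prod (P.map V)) S + 2 * b ∧
      ((P.map U).prod (P.map V)) S ≤ P.map (fun ω => (U ω, V ω)) S + 2 * b := by
  set J := P.map (fun ω => (U ω, V ω)) with hJ
  set R := (P.map U).prod (P.map V) with hR
  have : IsProbabilityMeasure J := Measure.isProbabilityMeasure_map (hU.prodMk hV).aemeasurable
  have : IsProbabilityMeasure (P.map U) := Measure.isProbabilityMeasure_map hU.aemeasurable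
  have : IsProbabilityMeasure (P.map V) := Measure.isProbabilityMeasure_map hV.aemeasurable
  -- On a union of cells the deviation is at most the sum of all cell deviations. The factor `½` in
  -- the coefficient makes this `2 * b`.
  have grid : ∀ S ∈ gridSets Y₁ Y₂, J S ≤ R S + 2 * b ∧ R S ≤ J S + 2 * b := by
    rintro _ ⟨m, n, f, g, I, hf, hg, rfl⟩
    classical
    set A : Fin m → Set Ω := fun i => U ⁻¹' (f ⁻¹' {i})
    set A' : Fin n → Set Ω := fun j => V ⁻¹' (g ⁻¹' {j})
    have hA : IsPartition (MeasurableSpace.comap U inferInstance) A :=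
      ⟨fun i => ⟨_, hf (measurableSet_singleton i), rfl⟩,
        fun i j hij => disjoint_left.2 fun ω hi hj => hij (Eq.trans (Eq.symm hi) hj),
        eq_univ_of_forall fun ω => mem_iUnion.2 ⟨f (U ω), rfl⟩⟩
    have hA' : IsPartition (MeasurableSpace.comap V inferInstance) A' :=
      ⟨fun i => ⟨_, hg (measurableSet_singleton i), rfl⟩,
        fun i j hij => disjoint_left.2 fun ω hi hj => hij (Eq.trans (Eq.symm hi) hj),
        eq_univ_of_forall fun ω => mem_iUnion.2 ⟨g (V ω), rfl⟩⟩
    set D : Fin m × Fin n → ℝ := fun z =>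
      P.real (A z.1 ∩ A' z.2) - P.real (A z.1) * P.real (A' z.2)
    have hsum : ∑ z : Fin m × Fin n, ENNReal.ofReal |D z| ≤ 2 * b := by
      rw [Fintype.sum_prod_type]
      have h1 : (2 : ℝ≥0∞)⁻¹ * ∑ i, ∑ j, ENNReal.ofReal |D (i, j)| ≤ b := by
        refine le_trans ?_ hb
        unfold betaCoeff
        gcongr
        exact le_iSup_of_le m <| le_iSup_of_le n <| le_iSup_of_le A <| le_iSup_of_le A' <|
          le_iSup_of_le hA <| le_iSup_of_le hA' le_rfl
      calc ∑ i, ∑ j, ENNReal.ofReal |D (i, j)|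
          = 2 * (2⁻¹ * ∑ i, ∑ j, ENNReal.ofReal |D (i, j)|) := by
            rw [← mul_assoc, ENNReal.mul_inv_cancel (by simp) (by simp), one_mul]
        _ ≤ 2 * b := by gcongr
    set F : Y₁ × Y₂ → Fin m × Fin n := fun y => (f y.1, g y.2)
    have hF : Measurable F := (hf.comp measurable_fst).prodMk (hg.comp measurable_snd)
    have hset : {y : Y₁ × Y₂ | (f y.1, g y.2) ∈ I} = F ⁻¹' (I.toFinset : Set (Fin m × Fin n)) := by
      ext y; simp [F]
    have hcell : ∀ z, F ⁻¹' {z} = (f ⁻¹' {z.1}) ×ˢ (g ⁻¹' {z.2}) := fun z => by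
      ext y; simp [F, Prod.ext_iff]
    have hJc : ∀ z, J (F ⁻¹' {z}) = ENNReal.ofReal (P.real (A z.1 ∩ A' z.2)) := fun z => by
      rw [hJ, Measure.map_apply (hU.prodMk hV) (hF (measurableSet_singleton z)), ofReal_measureReal,
        hcell]
      rfl
    have hRc : ∀ z, R (F ⁻¹' {z}) = ENNReal.ofReal (P.real (A z.1) * P.real (A' z.2)) := fun z => by
      rw [hcell, hR, Measure.prod_prod, ENNReal.ofReal_mul measureReal_nonneg, ofReal_measureReal,
        ofReal_measureReal, Measure.map_apply hU (hf (measurableSet_singleton _)),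
        Measure.map_apply hV (hg (measurableSet_singleton _))]
    have hle : ∀ μ ν : Measure (Y₁ × Y₂),
        (∀ z, μ (F ⁻¹' {z}) ≤ ν (F ⁻¹' {z}) + ENNReal.ofReal |D z|) →
        μ (F ⁻¹' (I.toFinset : Set (Fin m × Fin n))) ≤
          ν (F ⁻¹' (I.toFinset : Set (Fin m × Fin n))) + 2 * b := fun μ ν h => by
      rw [← sum_measure_preimage_singleton _ fun z _ => hF (measurableSet_singleton z),
        ← sum_measure_preimage_singleton _ fun z _ => hF (measurableSet_singleton z)]
      calc ∑ z ∈ I.toFinset, μ (F ⁻¹' {z})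
          ≤ ∑ z ∈ I.toFinset, (ν (F ⁻¹' {z}) + ENNReal.ofReal |D z|) :=
            Finset.sum_le_sum fun z _ => h z
        _ ≤ _ := by
            rw [Finset.sum_add_distrib]
            gcongr
            exact (Finset.sum_le_sum_of_subset (Finset.subset_univ _)).trans hsum
    rw [hset]
    refine ⟨hle _ _ fun z => ?_, hle _ _ fun z => ?_⟩
    · rw [hJc, hRc, ← ENNReal.ofReal_add (by positivity) (abs_nonneg _)]
      exact ENNReal.ofReal_le_ofReal (sub_le_iff_le_add'.1 (le_abs_self (D z)))
    · rw [hJc, hRc, ← ENNReal.ofReal_add (by positivity) (abs_nonneg _)]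
      refine ENNReal.ofReal_le_ofReal ?_
      have := neg_abs_le (D z)
      simp only [D] at this ⊢
      linarith
  have dense := Measure.MeasureDense.of_generateFrom_isSetAlgebra_finite (μ := J + R)
    isSetAlgebra_gridSets (generateFrom_gridSets (Y₁ := Y₁) (Y₂ := Y₂))
  -- The sum `J + R` dominates both laws, so one grid set `t` approximates `S` under both, at a cost
  -- of `ε / 2` for each.
  have happ : ∀ μ ν : Measure (Y₁ × Y₂), μ ≤ J + R → ν ≤ J + R →
      (∀ S ∈ gridSets Y₁ Y₂, μ S ≤ ν S + 2 * b) → μ S ≤ ν S + 2 * b := fun μ ν hμ hν h => by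
    refine ENNReal.le_of_forall_pos_le_add fun ε hε _ => ?_
    obtain ⟨t, ht, hlt⟩ := dense.approx S hS (measure_ne_top _ _) (ε / 2) (by positivity)
    have h1 : μ S ≤ μ t + ENNReal.ofReal (ε / 2) :=
      (measure_mono (s := S) (t := t ∪ symmDiff S t) fun x hx => by
        by_cases hxt : x ∈ t
        · exact Or.inl hxt
        · exact Or.inr (Or.inl ⟨hx, hxt⟩)).trans <| (measure_union_le _ _).trans <| by
        gcongr
        exact (hμ _).trans hlt.le
    have h2 : ν t ≤ ν S + ENNReal.ofReal (ε / 2) :=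
      (measure_mono (s := t) (t := S ∪ symmDiff S t) fun x hx => by
        by_cases hxt : x ∈ S
        · exact Or.inl hxt
        · exact Or.inr (Or.inr ⟨hx, hxt⟩)).trans <| (measure_union_le _ _).trans <| by
        gcongr
        exact (hν _).trans hlt.le
    have h3 : ENNReal.ofReal (ε / 2) + ENNReal.ofReal (ε / 2) = ε := by
      rw [← ENNReal.ofReal_add (by positivity) (by positivity), add_halves, ENNReal.ofReal_coe_nnreal]
    calc μ S ≤ (ν S + ENNReal.ofReal (ε / 2) + 2 * b) + ENNReal.ofReal (ε / 2) :=
          h1.trans (by gcongr; exact (h t ht).trans (by gcongr))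
      _ = ν S + 2 * b + (ENNReal.ofReal (ε / 2) + ENNReal.ofReal (ε / 2)) := by ring
      _ = _ := by rw [h3]
  exact ⟨happ J R (Measure.le_add_right le_rfl) (Measure.le_add_left le_rfl) fun S hS => (grid S hS).1,
    happ R J (Measure.le_add_left le_rfl) (Measure.le_add_right le_rfl) fun S hS => (grid S hS).2⟩

end Beta

/-! ### Configurations: measurability and the off-diagonal product. -/

/-- The points whose norm has integer part `n`. -/
def normShell (d n : ℕ) : Set (Space d) := {x | ⌊‖x‖⌋₊ = n}

theorem measurableSet_normShell (d n : ℕ) : MeasurableSet (normShell d n) :=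
  (Nat.measurable_floor.comp measurable_norm) (measurableSet_singleton n)

theorem isBounded_normShell (d n : ℕ) : Bornology.IsBounded (normShell d n) := by
  refine (Metric.isBounded_closedBall (x := (0 : Space d)) (r := n + 1)).subset fun x hx => ?_
  rw [mem_closedBall_zero_iff]
  have := (Nat.lt_floor_add_one ‖x‖).le
  rwa [show ⌊‖x‖⌋₊ = n from hx] at this

theorem countable_of_finite_over_bounded {d : ℕ} {M : Type*}
    {S : Set (Space d × M)}
    (hS : ∀ B : Set (Space d), Bornology.IsBounded B → (S ∩ B ×ˢ univ).Finite) : S.Countable := by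
  have : S = ⋃ n : ℕ, S ∩ normShell d n ×ˢ univ := by
    rw [← inter_iUnion, ← iUnion_prod_const, show ⋃ n, normShell d n = univ from
      eq_univ_of_forall fun x => mem_iUnion.2 ⟨⌊‖x‖⌋₊, rfl⟩]
    simp
  rw [this]
  exact countable_iUnion fun n => (hS _ (isBounded_normShell d n)).countable

section Configurations

variable {d : ℕ} {M : Type*} [MeasurableSpace M]

/-- The configuration has finite mass over every bounded set of locations. -/
def FiniteOverBounded (φ : Measure (Space d × M)) : Prop :=
  ∀ B : Set (Space d), Bornology.IsBounded B → φ (B ×ˢ univ) ≠ ∞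

theorem measurable_measure_restrict {α : Type*} [MeasurableSpace α] {s : Set α}
    (hs : MeasurableSet s) : Measurable fun μ : Measure α => μ.restrict s :=
  Measure.measurable_of_measurable_coe _ fun t ht => by
    simp_rw [Measure.restrict_apply ht]
    exact Measure.measurable_coe (ht.inter hs)

open Classical in
/-- The kernel sending a measure to its part over a shell when that part is finite. -/
noncomputable def shellKernel (d : ℕ) (M : Type*) [MeasurableSpace M] (n : ℕ) :
    Kernel (Measure (Space d × M)) (Space d × M) :=
  Kernel.piecewise (s := (fun φ => φ (normShell d n ×ˢ univ)) ⁻¹' {∞})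
    (Measure.measurable_coe ((measurableSet_normShell d n).prod .univ) (measurableSet_singleton ∞))
    0 ⟨fun φ => φ.restrict (normShell d n ×ˢ univ),
      measurable_measure_restrict ((measurableSet_normShell d n).prod .univ)⟩

/-- The tautological kernel on the space of measures, made s-finite by cutting off the infinite
parts. -/
noncomputable def configurationKernel (d : ℕ) (M : Type*) [MeasurableSpace M] :
    Kernel (Measure (Space d × M)) (Space d × M) :=
  Kernel.sum (shellKernel d M)

instance isSFiniteKernel_configurationKernel : IsSFiniteKernel (configurationKernel d M) := by
  have : ∀ n, IsSFiniteKernel (shellKernel d M n) := fun n => by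
    classical
    refine isSFiniteKernel_of_forall_ne_top _ fun φ => ?_
    unfold shellKernel
    rw [Kernel.piecewise_apply]
    split_ifs with h
    · simp
    · simpa using h
  unfold configurationKernel
  infer_instance

/-- Product kernels need s-finiteness, while the space of all measures also contains measures that
are not s-finite. Shells are bounded, so the cut-off leaves every configuration intact, and
functionals of configurations become measurable when written with this kernel. -/
theorem configurationKernel_apply {φ : Measure (Space d × M)} (hφ : FiniteOverBounded φ) :
    configurationKernel d M φ = φ := by
  classical
  have h1 : ∀ n, shellKernel d M n φ = φ.restrict (normShell d n ×ˢ univ) := fun n => by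
    unfold shellKernel
    rw [Kernel.piecewise_apply, if_neg]
    · rfl
    · exact hφ _ (isBounded_normShell d n)
  rw [configurationKernel, Kernel.sum_apply]
  simp_rw [h1]
  rw [← Measure.restrict_iUnion, ← iUnion_prod_const]
  · rw [show ⋃ n, normShell d n = univ from
      eq_univ_of_forall fun x => mem_iUnion.2 ⟨⌊‖x‖⌋₊, rfl⟩]
    simp
  · intro m n hmn
    refine disjoint_left.2 fun p hp hq => hmn ?_
    exact (show ⌊‖p.1‖⌋₊ = m from hp.1).symm.trans hq.1
  · exact fun n => (measurableSet_normShell d n).prod .univ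

theorem FiniteOverBounded.sFinite {φ : Measure (Space d × M)} (hφ : FiniteOverBounded φ) :
    SFinite φ := by
  rw [← configurationKernel_apply hφ]
  infer_instance

theorem measurable_shift_point (x : Space d) :
    Measurable fun p : Space d × M => (p.1 - x, p.2) := by fun_prop

theorem FiniteOverBounded.shift {φ : Measure (Space d × M)} (hφ : FiniteOverBounded φ)
    (x : Space d) : FiniteOverBounded (shift x φ) := fun B hB => by
  obtain ⟨r, hr⟩ := hB.subset_closedBall 0
  refine ne_top_of_le_ne_top (hφ (Metric.closedBall x r) Metric.isBounded_closedBall)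
    ((measure_mono (prod_mono_left hr)).trans ?_)
  rw [MPP.shift, Measure.map_apply (measurable_shift_point x) (measurableSet_closedBall.prod .univ)]
  refine measure_mono fun p hp => ?_
  simpa [dist_eq_norm] using hp

theorem measurable_shift (x : Space d) :
    Measurable (shift x : Measure (Space d × M) → Measure (Space d × M)) :=
  Measure.measurable_map _ (measurable_shift_point x)

theorem IsSimpleConfiguration.finiteOverBounded {φ : Measure (Space d × M)}
    (hφ : IsSimpleConfiguration φ) : FiniteOverBounded φ := by
  obtain ⟨S, hS, -, rfl⟩ := hφ
  intro B hB
  -- A bounded set need not be measurable, so it is enlarged to a ball before the sum of Dirac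
  -- masses is evaluated.
  obtain ⟨r, hr⟩ := hB.subset_closedBall 0
  refine ne_top_of_le_ne_top ?_ (measure_mono (prod_mono_left hr))
  have hA : MeasurableSet (Metric.closedBall (0 : Space d) r ×ˢ (univ : Set M)) :=
    measurableSet_closedBall.prod .univ
  have hfin := hS _ (Metric.isBounded_closedBall (x := (0 : Space d)) (r := r))
  rw [Measure.sum_apply _ hA]
  simp_rw [Measure.dirac_apply' _ hA]
  rw [tsum_subtype S fun p =>
    (Metric.closedBall (0 : Space d) r ×ˢ (univ : Set M)).indicator (1 : Space d × M → ℝ≥0∞) p,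
    indicator_indicator, ← tsum_subtype]
  simp only [Pi.one_apply, ENNReal.tsum_set_one, ne_eq]
  simpa using hfin

theorem sum_dirac_singleton_ne_zero_iff {α : Type*} [MeasurableSpace α] [MeasurableSingletonClass α]
    (S : Set α) (p : α) : Measure.sum (fun q : S => Measure.dirac (q : α)) {p} ≠ 0 ↔ p ∈ S := by
  rw [Measure.sum_apply _ (measurableSet_singleton p)]
  simp [ENNReal.tsum_eq_zero]

/-- The factorial square is the product measure off the diagonal. -/
theorem factorialSquare_eq [MeasurableSingletonClass M] {φ : Measure (Space d × M)}
    (hφ : IsSimpleConfiguration φ)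
    (hm : MeasurableSet {z : (Space d × M) × (Space d × M) | z.1 ≠ z.2}) :
    factorialSquare φ = (φ.prod φ).restrict {z | z.1 ≠ z.2} := by
  obtain ⟨S, hS, -, hφS⟩ := hφ
  have hSc : Countable S := (countable_of_finite_over_bounded hS).to_subtype
  have hpairs : distinctAtomPairs φ = S ×ˢ S ∩ {z | z.1 ≠ z.2} := by
    ext z
    simp only [distinctAtomPairs, hφS, mem_ofPred_eq, sum_dirac_singleton_ne_zero_iff, mem_inter_iff,
      mem_prod, and_assoc]
  ext A hA
  have h1 : ∀ z : S × S, ((z.1 : Space d × M), (z.2 : Space d × M)) =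
    ((Equiv.Set.prod S S).symm z : (Space d × M) × (Space d × M)) := fun z => rfl
  rw [factorialSquare, hpairs, Measure.restrict_apply hA, hφS, Measure.prod_sum,
    Measure.sum_apply _ hA, Measure.sum_apply _ (hA.inter hm)]
  simp_rw [Measure.dirac_prod_dirac, Measure.dirac_apply' _ hA, Measure.dirac_apply' _ (hA.inter hm),
    h1]
  rw [(Equiv.Set.prod S S).symm.tsum_eq fun z : ↥(S ×ˢ S) =>
    (A ∩ {z | z.1 ≠ z.2}).indicator (1 : (Space d × M) × (Space d × M) → ℝ≥0∞) z.1, tsum_subtype, tsum_subtype]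
  simp_rw [indicator_indicator]
  congr! 3
  ext z
  simp only [mem_inter_iff]
  tauto

end Configurations

/-! ### Moment measures of a stationary process. -/

section Processes

variable {d : ℕ} {M : Type*} [MeasurableSpace M] {Ω : Type*} [MeasurableSpace Ω] {P : Measure Ω}
  {X : Ω → Measure (Space d × M)}

theorem IsMarkedPointProcess.finiteOverBounded (hX : IsMarkedPointProcess X) (ω : Ω) :
    FiniteOverBounded (X ω) := (hX.simple ω).finiteOverBounded

/-- Measurable functionals of a stationary process have shift-invariant means. -/
theorem IsStationary.lintegral_shift (hstat : IsStationary P X) (hX : IsMarkedPointProcess X)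
    {G : Measure (Space d × M) → ℝ≥0∞} (hG : Measurable G) (x : Space d) :
    ∫⁻ ω, G (shift x (X ω)) ∂P = ∫⁻ ω, G (X ω) ∂P := by
  rw [← lintegral_map hG hX.measurable, ← hstat x,
    lintegral_map hG (g := fun ω => shift x (X ω)) ((measurable_shift x).comp hX.measurable)]

theorem shift_apply (x : Space d) (φ : Measure (Space d × M)) {A : Set (Space d × M)}
    (hA : MeasurableSet A) : shift x φ A = φ {p | (p.1 - x, p.2) ∈ A} :=
  Measure.map_apply (measurable_shift_point x) hA

/-- Moments of the number of points over bounded sets are finite as soon as this holds for the unit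
cube. -/
theorem IsStationary.lintegral_rpow_lt_top (hstat : IsStationary P X) (hX : IsMarkedPointProcess X)
    {s : ℝ} (hs : 1 ≤ s) (hmom : ∫⁻ ω, (X ω (closedUnitCube d ×ˢ univ)) ^ s ∂P < ∞)
    {B : Set (Space d)} (hB : Bornology.IsBounded B) :
    ∫⁻ ω, (X ω (B ×ˢ univ)) ^ s ∂P < ∞ := by
  have hs0 : 0 ≤ s := by linarith
  have hmeas : ∀ A : Set (Space d × M), MeasurableSet A → Measurable fun φ : Measure (Space d × M) =>
    (φ A) ^ s := fun A hA => (Measure.measurable_coe hA).pow_const s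
  have hcube : ∀ k : Fin d → ℤ, ∫⁻ ω, (X ω (cubeAt k ×ˢ univ)) ^ s ∂P < ∞ := fun k => by
    have h := hstat.lintegral_shift hX (hmeas _ ((measurableSet_unitCube d).prod .univ))
      (WithLp.toLp 2 fun i => (k i : ℝ))
    have hset : {p : Space d × M | (p.1 - (WithLp.toLp 2 fun i => (k i : ℝ)), p.2) ∈
        unitCube d ×ˢ univ} = cubeAt k ×ˢ univ := by
      ext p; simp [unitCube, cubeAt]
    simp_rw [shift_apply _ _ ((measurableSet_unitCube d).prod .univ), hset] at h
    rw [h]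
    refine lt_of_le_of_lt (lintegral_mono fun ω => ?_) hmom
    gcongr
    exact fun x hx i => Ico_subset_Icc_self (hx i)
  -- Cubes are added one at a time through `(a + b)^s ≤ 2^(s-1) (a^s + b^s)`, which needs `1 ≤ s`.
  have hfin : ∀ F : Finset (Fin d → ℤ),
      ∫⁻ ω, (X ω ((⋃ k ∈ F, cubeAt k) ×ˢ univ)) ^ s ∂P < ∞ := fun F => by
    classical
    induction F using Finset.induction_on with
    | empty => simp [ENNReal.zero_rpow_of_pos (by linarith : 0 < s)]
    | insert k F _ ih =>
      have hle : ∀ ω, (X ω ((⋃ l ∈ insert k F, cubeAt l) ×ˢ univ)) ^ s ≤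
          2 ^ (s - 1) * ((X ω (cubeAt k ×ˢ univ)) ^ s +
            (X ω ((⋃ l ∈ F, cubeAt l) ×ˢ univ)) ^ s) := fun ω => by
        rw [Finset.set_biUnion_insert, union_prod]
        exact (ENNReal.rpow_le_rpow (measure_union_le _ _) hs0).trans
          (ENNReal.rpow_add_le_mul_rpow_add_rpow _ _ hs)
      refine (lintegral_mono hle).trans_lt ?_
      rw [lintegral_const_mul' _ _ (by finiteness), lintegral_add_left (f := fun ω =>
        (X ω (cubeAt k ×ˢ univ)) ^ s)
        ((hmeas _ ((measurableSet_cubeAt k).prod .univ)).comp hX.measurable)]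
      exact ENNReal.mul_lt_top (by finiteness) (ENNReal.add_lt_top.2 ⟨hcube k, ih⟩)
  obtain ⟨r, hr⟩ := hB.subset_closedBall 0
  obtain ⟨n, hn⟩ := exists_nat_gt r
  refine lt_of_le_of_lt (lintegral_mono fun ω => ?_)
    (hfin (Fintype.piFinset fun _ => Finset.Icc (-(n : ℤ) - 1) n))
  gcongr
  intro x hx
  refine mem_biUnion (x := fun i => ⌊x i⌋) ?_ (mem_cubeAt_floor x)
  rw [Finset.mem_coe, Fintype.mem_piFinset]
  intro i
  have h1 : |x i| ≤ n := (PiLp.norm_apply_le x i).trans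
    ((mem_closedBall_zero_iff.1 (hr hx)).trans hn.le)
  rw [Finset.mem_Icc, Int.le_floor, ← Int.lt_add_one_iff, Int.floor_lt]
  push_cast
  constructor <;> linarith [abs_le.1 h1]

/-- The first moment measure. -/
noncomputable def firstMoment (P : Measure Ω) (X : Ω → Measure (Space d × M)) :
    Measure (Space d × M) := P.bind X

theorem lintegral_firstMoment (hX : IsMarkedPointProcess X) {f : Space d × M → ℝ≥0∞}
    (hf : Measurable f) : ∫⁻ p, f p ∂firstMoment P X = ∫⁻ ω, ∫⁻ p, f p ∂X ω ∂P :=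
  Measure.lintegral_bind hX.measurable.aemeasurable hf.aemeasurable

theorem firstMoment_apply (hX : IsMarkedPointProcess X) {A : Set (Space d × M)}
    (hA : MeasurableSet A) : firstMoment P X A = ∫⁻ ω, X ω A ∂P :=
  Measure.bind_apply hA hX.measurable.aemeasurable

theorem firstMoment_map_shift (hstat : IsStationary P X) (hX : IsMarkedPointProcess X)
    (x : Space d) :
    (firstMoment P X).map (fun p => (p.1 - x, p.2)) = firstMoment P X := by
  ext A hA
  rw [Measure.map_apply (measurable_shift_point x) hA, firstMoment_apply hX hA,
    firstMoment_apply hX (measurable_shift_point x hA),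
    ← hstat.lintegral_shift hX (Measure.measurable_coe hA) x]
  simp_rw [shift_apply x _ hA]
  rfl

/-- The mean measure of the marks of the points in the unit cube. -/
noncomputable def cubeMarks (P : Measure Ω) (X : Ω → Measure (Space d × M)) : Measure M :=
  ((firstMoment P X).restrict (unitCube d ×ˢ univ)).map Prod.snd

theorem cubeMarks_apply (hX : IsMarkedPointProcess X) {C : Set M} (hC : MeasurableSet C) :
    cubeMarks P X C = ∫⁻ ω, X ω (unitCube d ×ˢ C) ∂P := by
  rw [cubeMarks, Measure.map_apply measurable_snd hC, Measure.restrict_apply (measurable_snd hC),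
    ← firstMoment_apply hX ((measurableSet_unitCube d).prod hC)]
  congr 1
  ext p; simp [and_comm]

theorem intensity_eq_cubeMarks (hX : IsMarkedPointProcess X) :
    intensity P X = cubeMarks P X univ := (cubeMarks_apply hX .univ).symm

theorem palmMark_eq_cubeMarks (hX : IsMarkedPointProcess X) {C : Set M} (hC : MeasurableSet C) :
    palmMark P X C = (intensity P X)⁻¹ * cubeMarks P X C := by
  rw [cubeMarks_apply hX hC, palmMark]

/-- Campbell's formula in product form. The mean mark measure of a bounded set is finite, so no
exhaustion of the mark space is needed. -/
theorem firstMoment_eq_prod (hstat : IsStationary P X) (hX : IsMarkedPointProcess X)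
    (hfin : ∀ B : Set (Space d), Bornology.IsBounded B → ∫⁻ ω, X ω (B ×ˢ univ) ∂P < ∞) :
    IsFiniteMeasure (cubeMarks P X) ∧ firstMoment P X = volume.prod (cubeMarks P X) := by
  refine ⟨⟨?_⟩, (eq_volume_prod_of_shift_invariant (firstMoment P X)
    (firstMoment_map_shift hstat hX) (D := fun _ => univ) (fun _ => .univ) monotone_const
    (iUnion_const _) fun _ B hB => ?_).2⟩
  · rw [cubeMarks_apply hX .univ]
    exact hfin _ (isBounded_unitCube d)
  · obtain ⟨r, hr⟩ := hB.subset_closedBall 0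
    refine ne_top_of_le_ne_top ?_ (measure_mono (prod_mono_left hr))
    rw [firstMoment_apply hX (measurableSet_closedBall.prod .univ)]
    exact (hfin _ Metric.isBounded_closedBall).ne

variable [MeasurableSingletonClass M]

/-- `Measure.bind` is the intended mixture only for a measurable family. The kernel form provides
this measurability in `ω`. -/
theorem factorialSquare_eq_kernel (hX : IsMarkedPointProcess X)
    (hm : MeasurableSet {z : (Space d × M) × (Space d × M) | z.1 ≠ z.2}) (ω : Ω) :
    factorialSquare (X ω) =
      ((configurationKernel d M ×ₖ configurationKernel d M) (X ω)).restrict {z | z.1 ≠ z.2} := by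
  rw [factorialSquare_eq (hX.simple ω) hm, Kernel.prod_apply,
    configurationKernel_apply (hX.finiteOverBounded ω)]

theorem lintegral_factorialMoment₂ (hX : IsMarkedPointProcess X)
    (hm : MeasurableSet {z : (Space d × M) × (Space d × M) | z.1 ≠ z.2})
    {f : (Space d × M) × (Space d × M) → ℝ≥0∞} (hf : Measurable f) :
    ∫⁻ z, f z ∂factorialMoment₂ P X =
      ∫⁻ ω, ∫⁻ z in {z | z.1 ≠ z.2}, f z ∂((X ω).prod (X ω)) ∂P := by
  have hmeas : Measurable fun ω => factorialSquare (X ω) := by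
    simp_rw [factorialSquare_eq_kernel hX hm]
    exact (measurable_measure_restrict hm).comp ((Kernel.measurable _).comp hX.measurable)
  rw [factorialMoment₂, Measure.lintegral_bind hmeas.aemeasurable hf.aemeasurable]
  exact lintegral_congr fun ω => by rw [factorialSquare_eq (hX.simple ω) hm]

theorem lintegral_factorialMoment₂_shift (hstat : IsStationary P X) (hX : IsMarkedPointProcess X)
    (hm : MeasurableSet {z : (Space d × M) × (Space d × M) | z.1 ≠ z.2})
    {f : (Space d × M) × (Space d × M) → ℝ≥0∞} (hf : Measurable f) (x : Space d) :
    ∫⁻ z, f ((z.1.1 - x, z.1.2), (z.2.1 - x, z.2.2)) ∂factorialMoment₂ P X =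
      ∫⁻ z, f z ∂factorialMoment₂ P X := by
  set s : Space d × M → Space d × M := fun p => (p.1 - x, p.2)
  have hsm : Measurable s := measurable_shift_point x
  have hss : Measurable (Prod.map s s) := hsm.prodMap hsm
  rw [lintegral_factorialMoment₂ hX hm hf, lintegral_factorialMoment₂ hX hm
    (f := fun z => f ((z.1.1 - x, z.1.2), (z.2.1 - x, z.2.2))) (hf.comp hss)]
  -- Stationarity applies to functionals measurable on the whole space of measures. This one agrees
  -- with the off-diagonal double integral on configurations and on their shifts.
  have hG : Measurable fun φ : Measure (Space d × M) =>
      ∫⁻ z in {z | z.1 ≠ z.2}, f z ∂((configurationKernel d M ×ₖ configurationKernel d M) φ) :=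
    (Measure.measurable_lintegral hf).comp ((measurable_measure_restrict hm).comp (Kernel.measurable _))
  have h := hstat.lintegral_shift hX hG x
  simp_rw [Kernel.prod_apply, configurationKernel_apply (hX.finiteOverBounded _),
    configurationKernel_apply ((hX.finiteOverBounded _).shift x)] at h
  rw [← h]
  refine lintegral_congr fun ω => ?_
  have := (hX.finiteOverBounded ω).sFinite
  rw [shift, Measure.map_prod_map _ _ hsm hsm, setLIntegral_map hm hf hss]
  congr 2
  ext z
  simp [s, Prod.ext_iff]

end Processes

/-! ### The reduced measure of marked pairs. -/

section Reduced

variable {d : ℕ} {M : Type*} [MeasurableSpace M] {Ω : Type*} [MeasurableSpace Ω] {P : Measure Ω}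
  {X : Ω → Measure (Space d × M)}

/-- Passage from a pair of marked points to the first location, the displacement and the marks. -/
def relativePair {d : ℕ} {M : Type*} (z : (Space d × M) × (Space d × M)) :
    Space d × (Space d × (M × M)) :=
  (z.1.1, (z.2.1 - z.1.1, (z.1.2, z.2.2)))

theorem measurable_relativePair : Measurable (relativePair (d := d) (M := M)) := by
  unfold relativePair; fun_prop

/-- The mean number of pairs with first point in the unit cube, as a measure of displacement and
marks. -/
noncomputable def reducedPairs (P : Measure Ω) (X : Ω → Measure (Space d × M)) :
    Measure (Space d × (M × M)) :=
  (((factorialMoment₂ P X).map relativePair).restrict (unitCube d ×ˢ univ)).map Prod.snd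

/-- The mean number of pairs with first point in the unit cube, as a measure of displacement. -/
noncomputable def reducedPairsGround (P : Measure Ω) (X : Ω → Measure (Space d × M)) :
    Measure (Space d) := (reducedPairs P X).map Prod.fst

theorem reducedPairs_apply {E : Set (Space d × (M × M))} (hE : MeasurableSet E) :
    reducedPairs P X E = factorialMoment₂ P X (relativePair ⁻¹' (unitCube d ×ˢ E)) := by
  rw [reducedPairs, Measure.map_apply measurable_snd hE,
    Measure.restrict_apply (measurable_snd hE), Measure.map_apply measurable_relativePair
      ((measurable_snd hE).inter ((measurableSet_unitCube d).prod .univ))]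
  congr 1
  ext p; simp [and_comm]

variable [MeasurableEq M]

theorem measurableSet_ne_points :
    MeasurableSet {z : (Space d × M) × (Space d × M) | z.1 ≠ z.2} := by
  have : {z : (Space d × M) × (Space d × M) | z.1 ≠ z.2} =
      {z | z.1.1 ≠ z.2.1} ∪ {z | z.1.2 ≠ z.2.2} := by
    ext z
    simp only [mem_ofPred_eq, ne_eq, Prod.ext_iff, mem_union]
    tauto
  rw [this]
  exact (measurableSet_eq_fun (by fun_prop) (by fun_prop)).compl.union
    (measurableSet_eq_fun (by fun_prop) (by fun_prop)).compl

variable [MeasurableSingletonClass M]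

/-- The number of ordered pairs of distinct points in a set is at most the square of the number of
points. -/
theorem factorialMoment₂_prod_lt_top (hX : IsMarkedPointProcess X)
    (hfin : ∀ B : Set (Space d), Bornology.IsBounded B → ∫⁻ ω, (X ω (B ×ˢ univ)) ^ (2 : ℝ) ∂P < ∞)
    {B : Set (Space d)} (hB : Bornology.IsBounded B) :
    factorialMoment₂ P X ((B ×ˢ univ) ×ˢ (B ×ˢ univ)) < ∞ := by
  obtain ⟨r, hr⟩ := hB.subset_closedBall 0
  have hm : MeasurableSet (Metric.closedBall (0 : Space d) r ×ˢ (univ : Set M)) :=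
    measurableSet_closedBall.prod .univ
  refine (measure_mono (prod_mono (prod_mono_left hr) (prod_mono_left hr))).trans_lt ?_
  rw [← lintegral_indicator_one (hm.prod hm), lintegral_factorialMoment₂ hX measurableSet_ne_points
    (measurable_one.indicator (hm.prod hm))]
  refine (lintegral_mono fun ω => ?_).trans_lt (hfin _ (Metric.isBounded_closedBall (x := 0) (r := r)))
  have := (hX.finiteOverBounded ω).sFinite
  rw [lintegral_indicator_one (hm.prod hm), ENNReal.rpow_two, sq, ← Measure.prod_prod]
  exact Measure.restrict_le_self _

/-- A common shift of both points leaves the displacement fixed, so stationarity becomes translation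
invariance in the first location. The displacement is exhausted by balls because the mean number of
pairs with unrestricted displacement may be infinite. -/
theorem factorialMoment₂_map_relativePair (hstat : IsStationary P X) (hX : IsMarkedPointProcess X)
    (hfin : ∀ B : Set (Space d), Bornology.IsBounded B → ∫⁻ ω, (X ω (B ×ˢ univ)) ^ (2 : ℝ) ∂P < ∞) :
    SigmaFinite (reducedPairs P X) ∧
      (factorialMoment₂ P X).map relativePair = volume.prod (reducedPairs P X) := by
  refine eq_volume_prod_of_shift_invariant _ (fun x => ?_)
    (D := fun n : ℕ => Metric.closedBall 0 n ×ˢ univ)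
    (fun n => measurableSet_closedBall.prod .univ)
    (fun m n h => prod_mono_left (Metric.closedBall_subset_closedBall (by exact_mod_cast h)))
    ?_ fun n B hB => ?_
  · ext A hA
    have hA' : MeasurableSet (relativePair ⁻¹' A : Set ((Space d × M) × (Space d × M))) :=
      measurable_relativePair hA
    rw [Measure.map_apply (by fun_prop) hA, Measure.map_apply measurable_relativePair hA,
      Measure.map_apply measurable_relativePair ((measurable_shift_point x) hA),
      ← lintegral_indicator_one hA', ← lintegral_factorialMoment₂_shift hstat hX
      measurableSet_ne_points (measurable_one.indicator hA') x, ← lintegral_indicator_one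
      (measurable_relativePair ((measurable_shift_point x) hA))]
    refine lintegral_congr fun z => ?_
    have hz : z ∈ relativePair ⁻¹' ((fun p => (p.1 - x, p.2)) ⁻¹' A) ↔
        ((z.1.1 - x, z.1.2), (z.2.1 - x, z.2.2)) ∈ relativePair ⁻¹' A := by
      simp [relativePair]
    by_cases h : z ∈ relativePair ⁻¹' ((fun p => (p.1 - x, p.2)) ⁻¹' A)
    · rw [indicator_of_mem h, indicator_of_mem (hz.1 h)]; rfl
    · rw [indicator_of_notMem h, indicator_of_notMem (mt hz.2 h)]
  · rw [← iUnion_prod_const, Metric.iUnion_closedBall_nat, univ_prod_univ]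
  · obtain ⟨r, hr⟩ := hB.subset_closedBall 0
    have hm : MeasurableSet (Metric.closedBall (0 : Space d) r ×ˢ
        (Metric.closedBall (0 : Space d) n ×ˢ (univ : Set (M × M)))) :=
      measurableSet_closedBall.prod (measurableSet_closedBall.prod .univ)
    refine ne_top_of_le_ne_top ?_ (measure_mono (prod_mono_left hr))
    rw [Measure.map_apply measurable_relativePair hm]
    refine ne_top_of_le_ne_top (factorialMoment₂_prod_lt_top hX hfin
      (Metric.isBounded_closedBall (x := 0) (r := |r| + n))).ne (measure_mono ?_)
    rintro ⟨⟨x, u⟩, ⟨y, v⟩⟩ hz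
    simp only [relativePair, mem_preimage, mem_prod, mem_closedBall_zero_iff, mem_univ,
      and_true] at hz ⊢
    have h1 : ‖y‖ ≤ ‖x‖ + ‖y - x‖ := by simpa using norm_add_le x (y - x)
    have h2 := le_abs_self r
    have h3 : (0 : ℝ) ≤ n := n.cast_nonneg
    constructor <;> linarith [hz.1, hz.2]

theorem reducedPairsGround_lt_top (hX : IsMarkedPointProcess X)
    (hfin : ∀ B : Set (Space d), Bornology.IsBounded B → ∫⁻ ω, (X ω (B ×ˢ univ)) ^ (2 : ℝ) ∂P < ∞)
    {B : Set (Space d)} (hB : Bornology.IsBounded B) : reducedPairsGround P X B < ∞ := by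
  obtain ⟨r, hr⟩ := hB.subset_closedBall 0
  obtain ⟨t, ht⟩ := (isBounded_unitCube d).subset_closedBall 0
  refine (measure_mono hr).trans_lt ?_
  rw [reducedPairsGround, Measure.map_apply measurable_fst measurableSet_closedBall,
    reducedPairs_apply (measurable_fst measurableSet_closedBall)]
  refine (measure_mono ?_).trans_lt (factorialMoment₂_prod_lt_top hX hfin
      (Metric.isBounded_closedBall (x := 0) (r := |t| + |r|)))
  rintro ⟨⟨x, u⟩, ⟨y, v⟩⟩ hz
  simp only [relativePair, mem_preimage, mem_prod, mem_closedBall_zero_iff, mem_univ,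
    and_true] at hz ⊢
  have h0 := mem_closedBall_zero_iff.1 (ht hz.1)
  have h1 : ‖y‖ ≤ ‖x‖ + ‖y - x‖ := by simpa using norm_add_le x (y - x)
  have h2 := le_abs_self r
  have h3 := le_abs_self t
  have h4 := abs_nonneg r
  constructor <;> linarith [hz.2]

theorem sigmaFinite_of_bounded_lt_top {μ : Measure (Space d)}
    (h : ∀ B : Set (Space d), Bornology.IsBounded B → μ B < ∞) : SigmaFinite μ :=
  ⟨⟨{ set := fun n : ℕ => Metric.closedBall 0 n
      set_mem := fun _ => trivial
      finite := fun _ => h _ Metric.isBounded_closedBall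
      spanning := Metric.iUnion_closedBall_nat 0 }⟩⟩

theorem groundFactorialMoment₂_map (hstat : IsStationary P X) (hX : IsMarkedPointProcess X)
    (hfin : ∀ B : Set (Space d), Bornology.IsBounded B → ∫⁻ ω, (X ω (B ×ˢ univ)) ^ (2 : ℝ) ∂P < ∞) :
    (groundFactorialMoment₂ P X).map (fun z => (z.1, z.2 - z.1)) =
      volume.prod (reducedPairsGround P X) := by
  obtain ⟨hsf, h⟩ := factorialMoment₂_map_relativePair hstat hX hfin
  have : SigmaFinite (reducedPairsGround P X) :=
    sigmaFinite_of_bounded_lt_top fun _ => reducedPairsGround_lt_top hX hfin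
  have h2 : (volume : Measure (Space d)).prod (reducedPairsGround P X) =
      (volume.prod (reducedPairs P X)).map (Prod.map id Prod.fst) := by
    rw [reducedPairsGround, ← Measure.map_prod_map _ _ measurable_id measurable_fst, Measure.map_id]
  rw [h2, ← h, groundFactorialMoment₂, Measure.map_map (by fun_prop) (by fun_prop),
    Measure.map_map (by fun_prop) measurable_relativePair]
  rfl

theorem lintegral_groundFactorialMoment₂ (hstat : IsStationary P X) (hX : IsMarkedPointProcess X)
    (hfin : ∀ B : Set (Space d), Bornology.IsBounded B → ∫⁻ ω, (X ω (B ×ˢ univ)) ^ (2 : ℝ) ∂P < ∞)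
    {f : Space d × Space d → ℝ≥0∞} (hf : Measurable f) :
    ∫⁻ z, f z ∂groundFactorialMoment₂ P X =
      ∫⁻ x, ∫⁻ y, f (x, y + x) ∂reducedPairsGround P X := by
  have : SigmaFinite (reducedPairsGround P X) :=
    sigmaFinite_of_bounded_lt_top fun _ => reducedPairsGround_lt_top hX hfin
  have hf' : Measurable fun z : Space d × Space d => f (z.1, z.2 + z.1) := by fun_prop
  rw [← lintegral_prod (fun z : Space d × Space d => f (z.1, z.2 + z.1)) hf'.aemeasurable,
    ← groundFactorialMoment₂_map hstat hX hfin, lintegral_map hf' (by fun_prop)]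
  simp

theorem factorialMoment₂_rectangle (hstat : IsStationary P X) (hX : IsMarkedPointProcess X)
    (hfin : ∀ B : Set (Space d), Bornology.IsBounded B → ∫⁻ ω, (X ω (B ×ˢ univ)) ^ (2 : ℝ) ∂P < ∞)
    {B₁ B₂ : Set (Space d)} {C₁ C₂ : Set M} (hB₁ : MeasurableSet B₁) (hB₂ : MeasurableSet B₂)
    (hC₁ : MeasurableSet C₁) (hC₂ : MeasurableSet C₂) :
    factorialMoment₂ P X ((B₁ ×ˢ C₁) ×ˢ (B₂ ×ˢ C₂)) =
      ∫⁻ x in B₁, reducedPairs P X ({y | y + x ∈ B₂} ×ˢ (C₁ ×ˢ C₂)) := by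
  obtain ⟨hsf, h⟩ := factorialMoment₂_map_relativePair hstat hX hfin
  set A : Set (Space d × (Space d × (M × M))) :=
    {w | w.1 ∈ B₁ ∧ w.2.1 + w.1 ∈ B₂ ∧ w.2.2 ∈ C₁ ×ˢ C₂} with hA
  have hAm : MeasurableSet A := by
    refine (measurable_fst hB₁).inter (MeasurableSet.inter (s₁ := (fun w => w.2.1 + w.1) ⁻¹' B₂)
      ?_ ((measurable_snd.comp measurable_snd) (hC₁.prod hC₂)))
    exact (by fun_prop : Measurable fun w : Space d × (Space d × (M × M)) => w.2.1 + w.1) hB₂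
  have hpre : (B₁ ×ˢ C₁) ×ˢ (B₂ ×ˢ C₂) = relativePair ⁻¹' A := by
    ext z
    simp [hA, relativePair]
    tauto
  rw [hpre, ← Measure.map_apply measurable_relativePair hAm, h, Measure.prod_apply hAm,
    ← lintegral_indicator hB₁]
  refine lintegral_congr fun x => ?_
  by_cases hx : x ∈ B₁
  · rw [indicator_of_mem hx]
    congr 1
    ext w; simp [hA, hx]
  · rw [indicator_of_notMem hx]
    rw [show Prod.mk x ⁻¹' A = ∅ by ext w; simp [hA, hx], measure_empty]

/-- The diagonal carries no pairs of distinct points of a simple process. -/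
theorem reducedPairsGround_zero (hX : IsMarkedPointProcess X) :
    reducedPairsGround P X {0} = 0 := by
  set D : Set ((Space d × M) × (Space d × M)) := {z | z.1.1 = z.2.1}
  have hD : MeasurableSet D := measurableSet_eq_fun (by fun_prop) (by fun_prop)
  have h0 : factorialMoment₂ P X D = 0 := by
    rw [← lintegral_indicator_one hD, lintegral_factorialMoment₂ hX measurableSet_ne_points
      (measurable_one.indicator hD), ← lintegral_zero (μ := P)]
    refine lintegral_congr fun ω => ?_
    rw [← factorialSquare_eq (hX.simple ω) measurableSet_ne_points, lintegral_indicator_one hD,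
      factorialSquare, Measure.sum_apply _ hD]
    simp_rw [Measure.dirac_apply' _ hD]
    refine ENNReal.tsum_eq_zero.2 fun z => indicator_of_notMem ?_ _
    -- In a simple configuration atoms over the same location coincide, so no pair of distinct atoms
    -- lies in `D`.
    obtain ⟨⟨p, q⟩, hp, hq, hpq⟩ := z
    obtain ⟨S, -, hinj, hS⟩ := hX.simple ω
    simp only [hS, sum_dirac_singleton_ne_zero_iff] at hp hq
    exact fun h => hpq (hinj hp hq h)
  rw [reducedPairsGround, Measure.map_apply measurable_fst (measurableSet_singleton 0),
    reducedPairs_apply (measurable_fst (measurableSet_singleton 0))]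
  refine measure_mono_null (fun z hz => ?_) h0
  have : z.2.1 - z.1.1 = 0 := hz.2
  exact (sub_eq_zero.1 this).symm

end Reduced

/-! ### Uniqueness of reduced measures. -/

/-- The shear `(x, y) ↦ (x, y + x)` realises the integral that defines a reduced measure as the
image of a product with Lebesgue measure. -/
theorem lintegral_measure_add_mem {d : ℕ} (μ : Measure (Space d)) [SFinite μ]
    {B₁ B₂ : Set (Space d)} (hB₁ : MeasurableSet B₁) (hB₂ : MeasurableSet B₂) :
    (volume.prod μ).map (fun z => (z.1, z.2 + z.1)) (B₁ ×ˢ B₂) =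
      ∫⁻ x in B₁, μ {y | y + x ∈ B₂} := by
  have hm : MeasurableSet ((fun z : Space d × Space d => (z.1, z.2 + z.1)) ⁻¹' (B₁ ×ˢ B₂)) :=
    (by fun_prop : Measurable fun z : Space d × Space d => (z.1, z.2 + z.1)) (hB₁.prod hB₂)
  rw [Measure.map_apply (by fun_prop) (hB₁.prod hB₂), Measure.prod_apply hm,
    ← lintegral_indicator hB₁]
  refine lintegral_congr fun x => ?_
  by_cases hx : x ∈ B₁
  · rw [indicator_of_mem hx]
    congr 1
    ext y; simp [hx]
  · rw [indicator_of_notMem hx, show Prod.mk x ⁻¹' ((fun z : Space d × Space d =>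
      (z.1, z.2 + z.1)) ⁻¹' (B₁ ×ˢ B₂)) = ∅ by ext y; simp [hx], measure_empty]

/-- Bounded rectangles determine the sheared products. Undoing the shear and cancelling Lebesgue
measure recovers the two factors. -/
theorem eq_of_lintegral_measure_add_mem_eq {d : ℕ} {μ₁ μ₂ : Measure (Space d)}
    (h₁ : ∀ B, Bornology.IsBounded B → μ₁ B < ∞) (h₂ : ∀ B, Bornology.IsBounded B → μ₂ B < ∞)
    (h : ∀ B₁ B₂ : Set (Space d), MeasurableSet B₁ → MeasurableSet B₂ → Bornology.IsBounded B₁ →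
      Bornology.IsBounded B₂ →
      ∫⁻ x in B₁, μ₁ {y | y + x ∈ B₂} = ∫⁻ x in B₁, μ₂ {y | y + x ∈ B₂}) : μ₁ = μ₂ := by
  have := sigmaFinite_of_bounded_lt_top h₁
  have := sigmaFinite_of_bounded_lt_top h₂
  set T : Space d × Space d → Space d × Space d := fun z => (z.1, z.2 + z.1)
  have hT : Measurable T := by fun_prop
  have hmap : ((volume : Measure (Space d)).prod μ₁).map T = (volume.prod μ₂).map T := by
    refine Measure.ext_of_iUnion_eq_univ
      (s := fun n : ℕ => Metric.closedBall (0 : Space d) n ×ˢ Metric.closedBall (0 : Space d) n)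
      (eq_univ_of_forall fun z => ?_) fun n => ?_
    · obtain ⟨n, hn⟩ := exists_nat_ge (max ‖z.1‖ ‖z.2‖)
      refine mem_iUnion.2 ⟨n, ?_⟩
      simpa using hn
    -- If `x` and `y + x` both have norm at most `n`, then `y` lies in the ball of radius `2n`. So
    -- the sheared product is finite there, and rectangles determine it.
    · have hfin : IsFiniteMeasure ((((volume : Measure (Space d)).prod μ₁).map T).restrict
          (Metric.closedBall (0 : Space d) n ×ˢ Metric.closedBall (0 : Space d) n)) := ⟨by
        rw [Measure.restrict_apply_univ, lintegral_measure_add_mem _ measurableSet_closedBall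
          measurableSet_closedBall]
        refine (setLIntegral_mono' (g := fun _ => μ₁ (Metric.closedBall 0 (n + n)))
          measurableSet_closedBall fun x hx => measure_mono fun y hy => ?_).trans_lt ?_
        · rw [mem_closedBall_zero_iff] at hx ⊢
          have hy' : ‖y + x‖ ≤ n := mem_closedBall_zero_iff.1 hy
          have : ‖y‖ ≤ ‖y + x‖ + ‖x‖ := by simpa using norm_sub_le (y + x) x
          linarith
        · rw [setLIntegral_const]
          exact ENNReal.mul_lt_top (h₁ _ Metric.isBounded_closedBall)
            Metric.isBounded_closedBall.measure_lt_top⟩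
      refine Measure.ext_prod fun {s t} hs ht => ?_
      rw [Measure.restrict_apply (hs.prod ht), Measure.restrict_apply (hs.prod ht), prod_inter_prod,
        lintegral_measure_add_mem _ (hs.inter measurableSet_closedBall)
          (ht.inter measurableSet_closedBall),
        lintegral_measure_add_mem _ (hs.inter measurableSet_closedBall)
          (ht.inter measurableSet_closedBall)]
      exact h _ _ (hs.inter measurableSet_closedBall) (ht.inter measurableSet_closedBall)
        (Metric.isBounded_closedBall.subset inter_subset_right)
        (Metric.isBounded_closedBall.subset inter_subset_right)
  refine eq_of_volume_prod_eq (d := d) ?_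
  have := congrArg (Measure.map fun z : Space d × Space d => (z.1, z.2 - z.1)) hmap
  rwa [Measure.map_map (by fun_prop) hT, Measure.map_map (by fun_prop) hT,
    show (fun z : Space d × Space d => (z.1, z.2 - z.1)) ∘ T = id by ext z <;> simp [T],
    Measure.map_id, Measure.map_id] at this

/-! ### The reduced factorial moment measure and the two-point Palm mark kernel. -/

section Reduced

variable {d : ℕ} {M : Type*} [MeasurableSpace M] {Ω : Type*} [MeasurableSpace Ω] {P : Measure Ω}
  {X : Ω → Measure (Space d × M)} [MeasurableEq M] [MeasurableSingletonClass M]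

theorem groundFactorialMoment₂_rectangle (hstat : IsStationary P X) (hX : IsMarkedPointProcess X)
    (hfin : ∀ B : Set (Space d), Bornology.IsBounded B → ∫⁻ ω, (X ω (B ×ˢ univ)) ^ (2 : ℝ) ∂P < ∞)
    {B₁ B₂ : Set (Space d)} (hB₁ : MeasurableSet B₁) (hB₂ : MeasurableSet B₂) :
    groundFactorialMoment₂ P X (B₁ ×ˢ B₂) =
      ∫⁻ x in B₁, reducedPairsGround P X {y | y + x ∈ B₂} := by
  have : SigmaFinite (reducedPairsGround P X) :=
    sigmaFinite_of_bounded_lt_top fun _ => reducedPairsGround_lt_top hX hfin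
  rw [← lintegral_measure_add_mem _ hB₁ hB₂, ← groundFactorialMoment₂_map hstat hX hfin,
    Measure.map_map (by fun_prop) (by fun_prop)]
  rw [show (fun z : Space d × Space d => (z.1, z.2 + z.1)) ∘ (fun z => (z.1, z.2 - z.1)) = id by
    ext z <;> simp, Measure.map_id]

/-- The reduced factorial moment measure is the normalized mean number of pairs with first point in
the unit cube. -/
theorem isReducedFactorialMoment₂_iff (hstat : IsStationary P X) (hX : IsMarkedPointProcess X)
    (hfin : ∀ B : Set (Space d), Bornology.IsBounded B → ∫⁻ ω, (X ω (B ×ˢ univ)) ^ (2 : ℝ) ∂P < ∞)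
    (hpos : 0 < intensity P X) (hlt : intensity P X ≠ ∞) (ν : Measure (Space d)) :
    IsReducedFactorialMoment₂ P X ν ↔ intensity P X • ν = reducedPairsGround P X := by
  have hG : ∀ B : Set (Space d), Bornology.IsBounded B → reducedPairsGround P X B < ∞ :=
    fun _ => reducedPairsGround_lt_top hX hfin
  constructor
  · rintro ⟨hloc, hdis⟩
    refine eq_of_lintegral_measure_add_mem_eq (fun B hB => ?_) hG fun B₁ B₂ hB₁ hB₂ b₁ b₂ => ?_
    · exact ENNReal.mul_lt_top hlt.lt_top hB.measure_lt_top
    · rw [← groundFactorialMoment₂_rectangle hstat hX hfin hB₁ hB₂, hdis _ _ hB₁ hB₂ b₁ b₂,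
        ← lintegral_const_mul' _ _ hlt]
      rfl
  · intro h
    refine ⟨⟨fun x => ⟨Metric.ball x 1, Metric.ball_mem_nhds x one_pos, ?_⟩⟩,
      fun B₁ B₂ hB₁ hB₂ _ _ => ?_⟩
    · have h1 := hG _ (Metric.isBounded_ball (x := x) (r := 1))
      rw [← h, Measure.smul_apply, smul_eq_mul] at h1
      exact lt_top_iff_ne_top.2 fun h2 => by simp [h2, ENNReal.mul_top hpos.ne'] at h1
    · rw [groundFactorialMoment₂_rectangle hstat hX hfin hB₁ hB₂, ← h,
        ← lintegral_const_mul' _ _ hlt]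
      rfl

theorem existsUnique_isReducedFactorialMoment₂ (hstat : IsStationary P X)
    (hX : IsMarkedPointProcess X)
    (hfin : ∀ B : Set (Space d), Bornology.IsBounded B → ∫⁻ ω, (X ω (B ×ˢ univ)) ^ (2 : ℝ) ∂P < ∞)
    (hpos : 0 < intensity P X) (hlt : intensity P X ≠ ∞) :
    ∃! ν : Measure (Space d), IsReducedFactorialMoment₂ P X ν := by
  simp_rw [isReducedFactorialMoment₂_iff hstat hX hfin hpos hlt]
  refine ⟨(intensity P X)⁻¹ • reducedPairsGround P X, ?_, fun ν hν => ?_⟩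
  · simp only [smul_smul]
    rw [ENNReal.mul_inv_cancel hpos.ne' hlt, one_smul]
  · rw [← hν, smul_smul, ENNReal.inv_mul_cancel hpos.ne' hlt, one_smul]

theorem lintegral_groundFactorialMoment₂_rectangle (hstat : IsStationary P X)
    (hX : IsMarkedPointProcess X)
    (hfin : ∀ B : Set (Space d), Bornology.IsBounded B → ∫⁻ ω, (X ω (B ×ˢ univ)) ^ (2 : ℝ) ∂P < ∞)
    {f : Space d × Space d → ℝ≥0∞} (hf : Measurable f)
    {B₁ B₂ : Set (Space d)} (hB₁ : MeasurableSet B₁) (hB₂ : MeasurableSet B₂) :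
    ∫⁻ z in B₁ ×ˢ B₂, f z ∂groundFactorialMoment₂ P X =
      ∫⁻ x in B₁, ∫⁻ y in {y | y + x ∈ B₂}, f (x, y + x) ∂reducedPairsGround P X := by
  rw [← lintegral_indicator (hB₁.prod hB₂), lintegral_groundFactorialMoment₂ hstat hX hfin
    (hf.indicator (hB₁.prod hB₂)), ← lintegral_indicator hB₁]
  refine lintegral_congr fun x => ?_
  have hm : MeasurableSet {y | y + x ∈ B₂} := measurable_add_const x hB₂
  by_cases hx : x ∈ B₁
  · rw [indicator_of_mem hx, ← lintegral_indicator hm]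
    refine lintegral_congr fun y => ?_
    by_cases hy : y + x ∈ B₂
    · rw [indicator_of_mem (s := B₁ ×ˢ B₂) ⟨hx, hy⟩,
        indicator_of_mem (s := {y | y + x ∈ B₂}) hy]
    · rw [indicator_of_notMem (s := B₁ ×ˢ B₂) fun h => hy h.2,
        indicator_of_notMem (s := {y | y + x ∈ B₂}) hy]
  · rw [indicator_of_notMem hx]
    simp [indicator, hx]

/-- Disintegrating the reduced measure along the displacement, rather than the full measure along
both locations, makes the kernel a function of `x₂ - x₁` from the start. -/
theorem exists_isTwoPointPalmMark [StandardBorelSpace M] [Nonempty M] (hstat : IsStationary P X)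
    (hX : IsMarkedPointProcess X)
    (hfin : ∀ B : Set (Space d), Bornology.IsBounded B →
      ∫⁻ ω, (X ω (B ×ˢ univ)) ^ (2 : ℝ) ∂P < ∞) :
    ∃ Q : Kernel (Space d × Space d) (M × M), IsTwoPointPalmMark P X Q := by
  have hsf : SigmaFinite ((reducedPairs P X).map Prod.fst) :=
    sigmaFinite_of_bounded_lt_top fun _ => reducedPairsGround_lt_top hX hfin
  obtain ⟨K, hK, hKe⟩ := exists_isMarkovKernel_prod_eq (reducedPairs P X)
  have hsub : Measurable fun z : Space d × Space d => z.2 - z.1 := by fun_prop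
  refine ⟨K.comap _ hsub, inferInstance, fun B₁ B₂ C₁ C₂ hB₁ hB₂ hC₁ hC₂ => ?_, fun x₁ x₂ _ => ?_⟩
  · rw [lintegral_groundFactorialMoment₂_rectangle hstat hX hfin
      (Kernel.measurable_coe _ (hC₁.prod hC₂)) hB₁ hB₂,
      factorialMoment₂_rectangle hstat hX hfin hB₁ hB₂ hC₁ hC₂]
    refine lintegral_congr fun x => ?_
    rw [hKe {y | y + x ∈ B₂} _ (measurable_add_const x hB₂) (hC₁.prod hC₂)]
    simp [Kernel.comap_apply, reducedPairsGround]
  · simp [Kernel.comap_apply]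

/-- Every two-point Palm mark distribution is a density of the reduced measure of marked pairs. -/
theorem IsTwoPointPalmMark.reducedPairs_eq {Q : Kernel (Space d × Space d) (M × M)}
    (hQ : IsTwoPointPalmMark P X Q) (hstat : IsStationary P X)
    (hX : IsMarkedPointProcess X)
    (hfin : ∀ B : Set (Space d), Bornology.IsBounded B →
      ∫⁻ ω, (X ω (B ×ˢ univ)) ^ (2 : ℝ) ∂P < ∞)
    {C₁ C₂ : Set M} (hC₁ : MeasurableSet C₁) (hC₂ : MeasurableSet C₂) {B : Set (Space d)}
    (hB : MeasurableSet B) :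
    reducedPairs P X (B ×ˢ (C₁ ×ˢ C₂)) =
      ∫⁻ y in B, Q (0, y) (C₁ ×ˢ C₂) ∂reducedPairsGround P X := by
  have := hQ.markov
  have hC := hC₁.prod hC₂
  have hG : ∀ B : Set (Space d), Bornology.IsBounded B → reducedPairsGround P X B < ∞ :=
    fun _ => reducedPairsGround_lt_top hX hfin
  have hsf := sigmaFinite_of_bounded_lt_top hG
  have hq : Measurable fun y => Q (0, y) (C₁ ×ˢ C₂) :=
    (Kernel.measurable_coe Q hC).comp measurable_prodMk_left
  have happ : ∀ A, MeasurableSet A → ((reducedPairs P X).restrict (univ ×ˢ (C₁ ×ˢ C₂))).map Prod.fst A =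
      reducedPairs P X (A ×ˢ (C₁ ×ˢ C₂)) := fun A hA => by
    rw [Measure.map_apply measurable_fst hA, Measure.restrict_apply (measurable_fst hA)]
    congr 1
    ext z; simp
  have heq : ((reducedPairs P X).restrict (univ ×ˢ (C₁ ×ˢ C₂))).map Prod.fst =
      (reducedPairsGround P X).withDensity fun y => Q (0, y) (C₁ ×ˢ C₂) := by
    -- Both sides lie below `reducedPairsGround`, hence are finite on bounded sets. Uniqueness then
    -- reduces the claim to rectangles, where it is the density property of `Q`.
    refine eq_of_lintegral_measure_add_mem_eq (fun A hA => ?_) (fun A hA => ?_)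
      fun B₁ B₂ hB₁ hB₂ _ _ => ?_
    · refine lt_of_le_of_lt ?_ (hG A hA)
      exact Measure.map_mono Measure.restrict_le_self measurable_fst A
    · refine lt_of_le_of_lt ?_ (hG A hA)
      refine (?_ : _ ≤ (reducedPairsGround P X).withDensity 1 A).trans (by simp)
      exact withDensity_mono (Filter.Eventually.of_forall fun y => prob_le_one) A
    · have hadd : ∀ x, MeasurableSet {y | y + x ∈ B₂} := fun x => measurable_add_const x hB₂
      simp_rw [happ _ (hadd _), withDensity_apply _ (hadd _)]
      rw [← factorialMoment₂_rectangle hstat hX hfin hB₁ hB₂ hC₁ hC₂, hQ.density _ _ _ _ hB₁ hB₂ hC₁ hC₂,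
        lintegral_groundFactorialMoment₂_rectangle hstat hX hfin (Kernel.measurable_coe _ hC) hB₁ hB₂]
      refine lintegral_congr fun x => lintegral_congr_ae (ae_restrict_of_ae ?_)
      -- `Q` is shift-invariant only for distinct points; the excluded displacement `0` is a null
      -- set.
      have h0 : ∀ᵐ y ∂reducedPairsGround P X, y ≠ 0 :=
        measure_eq_zero_iff_ae_notMem.1 (reducedPairsGround_zero hX)
      filter_upwards [h0] with y hy
      rw [hQ.shift_invariant x (y + x) (by simpa using hy), add_sub_cancel_right]
  rw [← happ B hB, heq, withDensity_apply _ hB]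

end Reduced

/-! ### The covariance inequality. -/

/-- A product is at most the square of its larger factor. This separates the `p`-th moment of a
number of pairs into the `2p`-th moments of two counts. -/
theorem mul_rpow_le_rpow_add_rpow (a b : ℝ≥0∞) {p : ℝ} (hp : 0 ≤ p) :
    (a * b) ^ p ≤ a ^ (2 * p) + b ^ (2 * p) := by
  have h : ∀ c : ℝ≥0∞, c ^ (2 * p) = (c * c) ^ p := fun c => by
    rw [ENNReal.rpow_mul, ENNReal.rpow_two, sq]
  rcases le_total a b with hab | hab
  · rw [h b]
    exact le_add_left (by gcongr)
  · rw [h a]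
    exact le_add_right (by gcongr)

theorem symCube_mono (d : ℕ) {a b : ℝ} (h : a ≤ b) : symCube d a ⊆ symCube d b := fun _ hx i =>
  Icc_subset_Icc (neg_le_neg h) h (hx i)

theorem measurableSet_symCube (d : ℕ) (a : ℝ) : MeasurableSet (symCube d a) :=
  measurableSet_forall_coord fun _ => measurableSet_Icc

section Mixing

variable {d : ℕ} {M : Type*} [MeasurableSpace M] {Ω : Type*} [MeasurableSpace Ω] {P : Measure Ω}
  {X : Ω → Measure (Space d × M)}

theorem FiniteOverBounded.restrict {φ : Measure (Space d × M)} (hφ : FiniteOverBounded φ)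
    (A : Set (Space d × M)) : FiniteOverBounded (φ.restrict A) := fun B hB =>
  ne_top_of_le_ne_top (hφ B hB) (Measure.restrict_le_self _)

/-- Tonelli for two independent copies of the process: pairs with one point from each copy have the
product of the first moment measures as mean. -/
theorem lintegral_lintegral_firstMoment [IsProbabilityMeasure P] (hX : IsMarkedPointProcess X)
    [SFinite (firstMoment P X)]
    {f : (Space d × M) × (Space d × M) → ℝ≥0∞} (hf : Measurable f) :
    ∫⁻ ω, ∫⁻ ω', ∫⁻ z, f z ∂((X ω).prod (X ω')) ∂P ∂P =
      ∫⁻ p, ∫⁻ q, f (p, q) ∂firstMoment P X ∂firstMoment P X := by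
  have hsf : ∀ ω, SFinite (X ω) := fun ω => (hX.finiteOverBounded ω).sFinite
  rw [lintegral_firstMoment hX hf.lintegral_prod_right']
  refine lintegral_congr fun ω => ?_
  simp_rw [fun ω' => lintegral_prod (μ := X ω) (ν := X ω') f hf.aemeasurable]
  -- The s-finite kernel provides the joint measurability in `(ω', p)` that exchanging the integrals
  -- requires.
  set κ : Kernel (Ω × (Space d × M)) (Space d × M) :=
    (configurationKernel d M).comap (fun y => X y.1) (hX.measurable.comp measurable_fst)
  have hκ : ∀ y, κ y = X y.1 := fun y =>
    (Kernel.comap_apply _ _ _).trans (configurationKernel_apply (hX.finiteOverBounded _))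
  have hm : Measurable fun y : Ω × (Space d × M) => ∫⁻ q, f (y.2, q) ∂X y.1 := by
    have := Measurable.lintegral_kernel_prod_right' (κ := κ)
      (f := fun z : (Ω × (Space d × M)) × (Space d × M) => f (z.1.2, z.2)) (by fun_prop)
    simpa only [hκ] using this
  rw [lintegral_lintegral_swap hm.aemeasurable]
  refine lintegral_congr fun p => ?_
  rw [lintegral_firstMoment hX (by fun_prop)]

/-- Covariance inequality: for a function of pairs whose first point lies in `[-1,1]ᵈ` and whose
second point lies outside `[-1-b,1+b]ᵈ`, the integrals against the second factorial moment measure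
and against the product of the first moment measures differ little. -/
theorem factorialMoment₂_mixing [MeasurableEq M] [MeasurableSingletonClass M]
    [IsProbabilityMeasure P] (hX : IsMarkedPointProcess X) [SFinite (firstMoment P X)]
    {βs : ℝ → ℝ} (hβ : IsBetaRate P X βs) {b : ℝ} (hb : 1 ≤ b)
    {U V : Set (Space d)} (hU : MeasurableSet U) (hV : MeasurableSet V)
    (hUK : U ⊆ symCube d 1) (hVK : V ⊆ (symCube d (1 + b))ᶜ)
    {f : (Space d × M) × (Space d × M) → ℝ≥0∞} (hf : Measurable f)
    (hle : ∀ z, f z ≤ ((U ×ˢ univ) ×ˢ (V ×ˢ univ)).indicator 1 z)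
    {p q : ℝ} (hpq : p.HolderConjugate q) {m : ℝ≥0∞}
    (hm : ∫⁻ ω, X ω (U ×ˢ univ) ^ (2 * p) ∂P + ∫⁻ ω, X ω (V ×ˢ univ) ^ (2 * p) ∂P ≤ m) :
    ∫⁻ z, f z ∂factorialMoment₂ P X ≤
        ∫⁻ p, ∫⁻ q, f (p, q) ∂firstMoment P X ∂firstMoment P X +
          m ^ (1 / p) * (2 * ENNReal.ofReal (βs b)) ^ (1 / q) ∧
      ∫⁻ p, ∫⁻ q, f (p, q) ∂firstMoment P X ∂firstMoment P X ≤
        ∫⁻ z, f z ∂factorialMoment₂ P X +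
          m ^ (1 / p) * (2 * ENNReal.ofReal (βs b)) ^ (1 / q) := by
  have hsf : ∀ ω, SFinite (X ω) := fun ω => (hX.finiteOverBounded ω).sFinite
  have hp0 : 0 ≤ p := hpq.nonneg
  have hUm : MeasurableSet (U ×ˢ (univ : Set M)) := hU.prod .univ
  have hVm : MeasurableSet (V ×ˢ (univ : Set M)) := hV.prod .univ
  set S₁ : Set (Space d × M) := symCube d 1 ×ˢ univ
  set S₂ : Set (Space d × M) := (symCube d (1 + b))ᶜ ×ˢ univ
  have hS₁ : MeasurableSet S₁ := (measurableSet_symCube d 1).prod .univ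
  have hS₂ : MeasurableSet S₂ := (measurableSet_symCube d (1 + b)).compl.prod .univ
  set Y₁ : Ω → Measure (Space d × M) := fun ω => (X ω).restrict S₁
  set Y₂ : Ω → Measure (Space d × M) := fun ω => (X ω).restrict S₂
  have hY₁ : Measurable Y₁ := (measurable_measure_restrict hS₁).comp hX.measurable
  have hY₂ : Measurable Y₂ := (measurable_measure_restrict hS₂).comp hX.measurable
  have hsupp : Function.support f ⊆ (U ×ˢ univ) ×ˢ (V ×ˢ univ) := fun z hz => by
    by_contra h
    exact hz (le_antisymm ((hle z).trans (indicator_of_notMem h _).le) zero_le)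
  set C := configurationKernel d M
  have hC₁ : ∀ ω, C (Y₁ ω) = Y₁ ω := fun ω =>
    configurationKernel_apply ((hX.finiteOverBounded ω).restrict _)
  have hC₂ : ∀ ω, C (Y₂ ω) = Y₂ ω := fun ω =>
    configurationKernel_apply ((hX.finiteOverBounded ω).restrict _)
  -- The pair sum depends on the process only through its restrictions to the inner cube and to the
  -- far region. Its mean under their joint law `J` is the second factorial moment, and under the
  -- product law `I` it is the product of first moments.
  set h : Measure (Space d × M) × Measure (Space d × M) → ℝ≥0∞ := fun y =>
    ∫⁻ z, f z ∂((C ∥ₖ C) y) with hh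
  have hhm : Measurable h := (Measure.measurable_lintegral hf).comp (Kernel.measurable _)
  have hhY : ∀ ω ω', h (Y₁ ω, Y₂ ω') = ∫⁻ z, f z ∂((X ω).prod (X ω')) := fun ω ω' => by
    simp only [hh, Kernel.parallelComp_apply, hC₁, hC₂]
    rw [Measure.prod_restrict, ← lintegral_indicator (hS₁.prod hS₂), indicator_eq_self.2]
    exact hsupp.trans (prod_mono (prod_mono_left hUK) (prod_mono_left hVK))
  set J := P.map fun ω => (Y₁ ω, Y₂ ω)
  set I := (P.map Y₁).prod (P.map Y₂)
  have hYm : Measurable fun ω => (Y₁ ω, Y₂ ω) := hY₁.prodMk hY₂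
  have : IsProbabilityMeasure J := Measure.isProbabilityMeasure_map hYm.aemeasurable
  have : IsProbabilityMeasure (P.map Y₁) := Measure.isProbabilityMeasure_map hY₁.aemeasurable
  have : IsProbabilityMeasure (P.map Y₂) := Measure.isProbabilityMeasure_map hY₂.aemeasurable
  have hJ : ∫⁻ y, h y ∂J = ∫⁻ z, f z ∂factorialMoment₂ P X := by
    rw [lintegral_map hhm hYm, lintegral_factorialMoment₂ hX measurableSet_ne_points hf]
    refine lintegral_congr fun ω => ?_
    -- `U` and `V` are disjoint, so `f` vanishes on the diagonal and the restriction to distinct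
    -- points drops out.
    rw [hhY, ← lintegral_indicator measurableSet_ne_points, indicator_eq_self.2]
    intro z hz heq
    obtain ⟨h1, h2⟩ := hsupp hz
    rw [← heq] at h2
    exact hVK h2.1 (symCube_mono d (by linarith) (hUK h1.1))
  have hR : ∫⁻ y, h y ∂I = ∫⁻ p, ∫⁻ q, f (p, q) ∂firstMoment P X ∂firstMoment P X := by
    rw [← lintegral_lintegral_firstMoment hX hf, lintegral_prod _ hhm.aemeasurable,
      lintegral_map hhm.lintegral_prod_right' hY₁]
    refine lintegral_congr fun ω => ?_
    rw [lintegral_map (f := fun y => h (Y₁ ω, y)) (hhm.comp measurable_prodMk_left) hY₂]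
    exact lintegral_congr fun ω' => hhY ω ω'
  set G₁ : Measure (Space d × M) → ℝ≥0∞ := fun φ => C φ (U ×ˢ univ) ^ (2 * p)
  set G₂ : Measure (Space d × M) → ℝ≥0∞ := fun φ => C φ (V ×ˢ univ) ^ (2 * p)
  have hG₁ : Measurable G₁ := (Kernel.measurable_coe C hUm).pow_const _
  have hG₂ : Measurable G₂ := (Kernel.measurable_coe C hVm).pow_const _
  have hG₁' : Measurable fun y : Measure (Space d × M) × Measure (Space d × M) => G₁ y.1 :=
    hG₁.comp measurable_fst
  have hG₂' : Measurable fun y : Measure (Space d × M) × Measure (Space d × M) => G₂ y.2 :=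
    hG₂.comp measurable_snd
  -- Each summand depends on one coordinate only, and `J` and `I` have the same marginals. So the
  -- same `m` bounds the `p`-th moment of `h` under both laws.
  have hhp : ∀ y, h y ^ p ≤ G₁ y.1 + G₂ y.2 := fun y => by
    refine le_trans ?_ (mul_rpow_le_rpow_add_rpow _ _ hp0)
    gcongr
    refine (lintegral_mono hle).trans ?_
    rw [lintegral_indicator_one (hUm.prod hVm), Kernel.parallelComp_apply, Measure.prod_prod]
  have hmY : ∫⁻ ω, G₁ (Y₁ ω) ∂P + ∫⁻ ω, G₂ (Y₂ ω) ∂P ≤ m := by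
    refine le_trans (add_le_add (lintegral_mono fun ω => ?_) (lintegral_mono fun ω => ?_)) hm
    · simp only [G₁, hC₁]
      gcongr
      exact Measure.restrict_le_self
    · simp only [G₂, hC₂]
      gcongr
      exact Measure.restrict_le_self
  have hJp : ∫⁻ y, h y ^ p ∂J ≤ m := by
    refine ((lintegral_mono hhp).trans ?_).trans hmY
    rw [lintegral_add_left hG₁',
      lintegral_map hG₁' hYm,
      lintegral_map hG₂' hYm]
  have hRp : ∫⁻ y, h y ^ p ∂I ≤ m := by
    refine ((lintegral_mono hhp).trans ?_).trans hmY
    rw [lintegral_add_left hG₁', ← lintegral_map hG₁ hY₁,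
      ← lintegral_map hG₂ hY₂, lintegral_prod _ hG₁'.aemeasurable,
      lintegral_prod _ hG₂'.aemeasurable]
    simp
  have hbeta := hβ.bound 1 b (by norm_num) hb
  have hdev := fun S hS => joint_prod_measure_le P hY₁ hY₂ (S := S) hS hbeta
  have hq0 := hpq.symm.nonneg
  rw [← hJ, ← hR]
  constructor
  · refine (lintegral_le_add_of_measure_le_add J I (fun S hS => (hdev S hS).1) hpq hhm).trans ?_
    gcongr
  · refine (lintegral_le_add_of_measure_le_add I J (fun S hS => (hdev S hS).2) hpq hhm).trans ?_
    gcongr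

/-- The cube of side length two with lower corner `k`. -/
def doubleCubeAt {d : ℕ} (k : Fin d → ℤ) : Set (Space d) := {x | ∀ i, x i - k i ∈ Ico (0 : ℝ) 2}

theorem measurableSet_doubleCubeAt (k : Fin d → ℤ) : MeasurableSet (doubleCubeAt k) := by
  have : doubleCubeAt k = {x : Space d | ∀ i, x i ∈ (fun t : ℝ => t - k i) ⁻¹' Ico (0 : ℝ) 2} := rfl
  rw [this]
  exact measurableSet_forall_coord fun i => (measurable_sub_const _) measurableSet_Ico

theorem isBounded_doubleCubeAt_zero : Bornology.IsBounded (doubleCubeAt (0 : Fin d → ℤ)) := by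
  refine isBounded_of_forall_coord 2 fun x hx i => ?_
  have := hx i
  simp only [Pi.zero_apply, Int.cast_zero, sub_zero, mem_Ico] at this
  rw [abs_of_nonneg this.1]
  exact this.2.le

theorem IsStationary.lintegral_doubleCubeAt (hstat : IsStationary P X)
    (hX : IsMarkedPointProcess X) (s : ℝ) (k : Fin d → ℤ) :
    ∫⁻ ω, X ω (doubleCubeAt k ×ˢ univ) ^ s ∂P = ∫⁻ ω, X ω (doubleCubeAt 0 ×ˢ univ) ^ s ∂P := by
  have hm : MeasurableSet (doubleCubeAt (0 : Fin d → ℤ) ×ˢ (univ : Set M)) :=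
    (measurableSet_doubleCubeAt 0).prod .univ
  have h := hstat.lintegral_shift hX ((Measure.measurable_coe hm).pow_const s)
    (WithLp.toLp 2 fun i => (k i : ℝ))
  have hset : {p : Space d × M | (p.1 - (WithLp.toLp 2 fun i => (k i : ℝ)), p.2) ∈
      doubleCubeAt (0 : Fin d → ℤ) ×ˢ univ} = doubleCubeAt k ×ˢ univ := by
    ext p; simp [doubleCubeAt]
  simp_rw [shift_apply _ _ hm, hset] at h
  exact h

theorem volume_preimage_sub (B : Set (Space d)) (x : Space d) :
    volume ((fun y => y - x) ⁻¹' B) = volume B := by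
  simp_rw [sub_eq_add_neg]
  exact measure_preimage_add_right _ _ _

/-- Far from the origin, the mean number of marked pairs is close to the one of independent points. -/
theorem reducedPairs_mixing [MeasurableEq M] [MeasurableSingletonClass M]
    [IsProbabilityMeasure P] (hX : IsMarkedPointProcess X) (hstat : IsStationary P X)
    [IsFiniteMeasure (cubeMarks P X)]
    (hΛ : firstMoment P X = volume.prod (cubeMarks P X))
    {βs : ℝ → ℝ} (hβ : IsBetaRate P X βs) {b : ℝ} (hb : 1 ≤ b)
    {k : Fin d → ℤ} (hk : ∃ i, b + 3 ≤ |(k i : ℝ)|) {p q : ℝ} (hpq : p.HolderConjugate q)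
    {m : ℝ≥0∞} (hm : ∫⁻ ω, X ω (unitCube d ×ˢ univ) ^ (2 * p) ∂P +
      ∫⁻ ω, X ω (doubleCubeAt 0 ×ˢ univ) ^ (2 * p) ∂P ≤ m)
    {C₁ C₂ : Set M} (hC₁ : MeasurableSet C₁) (hC₂ : MeasurableSet C₂)
    {B : Set (Space d)} (hB : MeasurableSet B) (hBk : B ⊆ cubeAt k) :
    reducedPairs P X (B ×ˢ (C₁ ×ˢ C₂)) ≤ cubeMarks P X C₁ * cubeMarks P X C₂ * volume B +
        m ^ (1 / p) * (2 * ENNReal.ofReal (βs b)) ^ (1 / q) ∧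
      cubeMarks P X C₁ * cubeMarks P X C₂ * volume B ≤ reducedPairs P X (B ×ˢ (C₁ ×ˢ C₂)) +
        m ^ (1 / p) * (2 * ENNReal.ofReal (βs b)) ^ (1 / q) := by
  set E : Set ((Space d × M) × (Space d × M)) :=
    relativePair ⁻¹' (unitCube d ×ˢ (B ×ˢ (C₁ ×ˢ C₂))) with hE
  have hEm : MeasurableSet E :=
    measurable_relativePair ((measurableSet_unitCube d).prod (hB.prod (hC₁.prod hC₂)))
  have h1 : reducedPairs P X (B ×ˢ (C₁ ×ˢ C₂)) =
      ∫⁻ z, E.indicator 1 z ∂factorialMoment₂ P X := by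
    rw [lintegral_indicator_one hEm, reducedPairs_apply (hB.prod (hC₁.prod hC₂))]
  have h2 : cubeMarks P X C₁ * cubeMarks P X C₂ * volume B =
      ∫⁻ p, ∫⁻ q, E.indicator 1 (p, q) ∂firstMoment P X ∂firstMoment P X := by
    -- For a first point in the unit cube with mark in `C₁`, the second location ranges over a
    -- translate of `B`, which has the same volume.
    have hin : ∀ p : Space d × M, ∫⁻ q, E.indicator 1 (p, q) ∂firstMoment P X =
        (unitCube d ×ˢ C₁).indicator (fun _ => volume B * cubeMarks P X C₂) p := fun p => by
      have : ∀ q, E.indicator (1 : _ × _ → ℝ≥0∞) (p, q) = (Prod.mk p ⁻¹' E).indicator 1 q :=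
        fun q => rfl
      simp_rw [this]
      rw [lintegral_indicator_one (measurable_prodMk_left hEm), hΛ]
      by_cases hp : p ∈ unitCube d ×ˢ C₁
      · rw [indicator_of_mem hp, ← volume_preimage_sub B p.1, ← Measure.prod_prod]
        congr 1
        ext q
        simp [hE, relativePair, hp.1, hp.2]
      · rw [indicator_of_notMem hp, show Prod.mk p ⁻¹' E = ∅ from ?_, measure_empty]
        ext q
        simp only [hE, relativePair, mem_preimage, mem_prod, mem_empty_iff_false, iff_false]
        exact fun h => hp ⟨h.1, h.2.2.1⟩
    simp_rw [hin]
    rw [lintegral_indicator_const ((measurableSet_unitCube d).prod hC₁), hΛ, Measure.prod_prod,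
      volume_unitCube]
    ring
  have : SFinite (firstMoment P X) := by rw [hΛ]; infer_instance
  rw [h1, h2]
  refine factorialMoment₂_mixing hX hβ hb (measurableSet_unitCube d)
    (measurableSet_doubleCubeAt k) (fun x hx i => ?_) (fun y hy hyK => ?_)
    (measurable_one.indicator hEm) (fun z => ?_) hpq
    (by rwa [hstat.lintegral_doubleCubeAt hX])
  · exact ⟨by linarith [(hx i).1], (hx i).2.le⟩
  -- The `3` in `b + 3` is `1 + 2`: the half-side of the inner cube plus the side of the double
  -- cube. If `k i ≤ -(b + 3)`, then `y i < k i + 2 ≤ -(1 + b)`.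
  · obtain ⟨i, hi⟩ := hk
    have h3 := hy i
    have h4 := hyK i
    rcases le_total 0 (k i : ℝ) with h0 | h0
    · rw [abs_of_nonneg h0] at hi
      linarith [h3.1, h4.2]
    · rw [abs_of_nonpos h0] at hi
      linarith [h3.2, h4.1]
  · refine indicator_le_indicator_of_subset (fun z hz => ?_) (fun _ => zero_le) z
    -- A point of the unit cube plus a displacement in the unit cube at `k` lies in the double cube
    -- at `k`.
    obtain ⟨hx, hy, -⟩ := hz
    refine ⟨⟨hx, trivial⟩, ⟨fun i => ?_, trivial⟩⟩
    have h3 := hx i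
    have h4 := hBk hy i
    simp only [relativePair, PiLp.sub_apply] at h3 h4
    exact ⟨by linarith [h3.1, h4.1], by linarith [h3.2, h4.2]⟩

end Mixing

/-! ### Summation over the lattice. -/

theorem exists_norm_eq_abs {d : ℕ} {k : Fin d → ℤ} (hk : 0 < ‖k‖) : ∃ i, ‖k‖ ≤ |(k i : ℝ)| := by
  by_contra! h
  exact lt_irrefl _ ((pi_norm_lt_iff hk).2 fun i => by rw [Int.norm_eq_abs]; exact h i)

/-- A radially decreasing rate with a finite moment integral is summable over the lattice. -/
theorem tsum_lattice_lt_top {d : ℕ} (hd : 1 ≤ d) {g : ℝ → ℝ} (hg : AntitoneOn g (Ici 1))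
    (hint : IntegrableOn (fun r : ℝ => r ^ (d - 1) * g r) (Ici 1)) :
    ∑' k : Fin d → ℤ, (if 6 ≤ ‖k‖ then ENNReal.ofReal (g (‖k‖ - 3)) else 0) < ∞ := by
  have : Nonempty (Fin d) := ⟨⟨0, hd⟩⟩
  -- Points `x` of the unit cube at `k` satisfy `|‖x‖ - ‖k‖| ≤ 1`, so `‖x‖ - 4 ≤ ‖k‖ - 3` and `g
  -- (‖k‖ - 3) ≤ g (‖x‖ - 4)`. For `6 ≤ ‖k‖` both arguments are at least `1`, where `g` is monotone.
  set f : ℝ → ℝ := (Ici 5).indicator fun r => g (r - 4) with hf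
  have hshift : IntegrableOn (fun r : ℝ => (r - 4) ^ (d - 1) * g (r - 4)) (Ici 5) := by
    have h := (measurePreserving_sub_right (volume : Measure ℝ) 4).integrableOn_comp_preimage
      (MeasurableEquiv.subRight (4 : ℝ)).measurableEmbedding (s := Ici 1)
      (f := fun r : ℝ => r ^ (d - 1) * g r)
    have hpre : (fun r : ℝ => r - 4) ⁻¹' Ici 1 = Ici 5 := by
      ext r; simp only [mem_preimage, mem_Ici]; constructor <;> intro h <;> linarith
    rw [hpre] at h
    exact h.2 hint
  -- The shift costs only a bounded factor in the weight, since `r ≤ 5 (r - 4)` for `5 ≤ r`.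
  have hmul : IntegrableOn (fun r : ℝ => r ^ (d - 1) * g (r - 4)) (Ici 5) := by
    have h := Integrable.bdd_mul (μ := volume.restrict (Ici (5 : ℝ))) (c := 5 ^ (d - 1)) hshift
      (f := fun r : ℝ => (r / (r - 4)) ^ (d - 1))
      (((measurable_id.div (measurable_id.sub_const 4)).pow_const (d - 1)).aestronglyMeasurable) ?_
    · refine h.congr ?_
      filter_upwards [ae_restrict_mem measurableSet_Ici] with r hr
      have : r - 4 ≠ 0 := by have : (5 : ℝ) ≤ r := hr; linarith
      rw [← mul_assoc, ← mul_pow, div_mul_cancel₀ _ this]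
    · filter_upwards [ae_restrict_mem measurableSet_Ici] with r hr
      have hr' : (5 : ℝ) ≤ r := hr
      have h4 : 0 < r - 4 := by linarith
      have h5 : 0 ≤ r / (r - 4) := div_nonneg (by linarith) h4.le
      rw [Real.norm_of_nonneg (pow_nonneg h5 _)]
      refine pow_le_pow_left₀ h5 ?_ _
      rw [div_le_iff₀ h4]
      linarith
  -- Polar integration is done in the sup norm of `Fin d → ℝ`, which matches the norm of the lattice
  -- points.
  have hfint : Integrable (fun x : Fin d → ℝ => f ‖x‖) := by
    rw [integrable_fun_norm_addHaar]
    have h1 : (fun y : ℝ => y ^ (Module.finrank ℝ (Fin d → ℝ) - 1) • f y) =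
        (Ici 5).indicator fun r : ℝ => r ^ (d - 1) * g (r - 4) := by
      ext y
      by_cases hy : y ∈ Ici (5 : ℝ) <;> simp [hf, hy]
    rw [h1]
    exact ((integrable_indicator_iff measurableSet_Ici).2 hmul).integrableOn
  set T : (Fin d → ℤ) → Set (Fin d → ℝ) := fun k => univ.pi fun i => Ico (k i : ℝ) (k i + 1)
  have hT : ∀ k, MeasurableSet (T k) := fun k => MeasurableSet.univ_pi fun _ => measurableSet_Ico
  have hvol : ∀ k, volume (T k) = 1 := fun k => by
    simp only [T]; rw [Real.volume_pi_Ico]; simp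
  have hdisj : Pairwise fun k l => Disjoint (T k) (T l) := fun k l hkl =>
    disjoint_left.2 fun x hx hy => hkl <| funext fun i => by
      have h1 := hx i trivial
      have h2 := hy i trivial
      rw [← Int.floor_eq_iff.2 ⟨h1.1, h1.2⟩, ← Int.floor_eq_iff.2 ⟨h2.1, h2.2⟩]
  have hnorm : ∀ k, ∀ x ∈ T k, |‖x‖ - ‖k‖| ≤ 1 := fun k x hx => by
    have h0 : ‖fun i => (k i : ℝ)‖ = ‖k‖ := by
      simp only [Pi.norm_def]
      congr 2
    rw [← h0]
    refine (abs_norm_sub_norm_le _ _).trans ((pi_norm_le_iff_of_nonneg zero_le_one).2 fun i => ?_)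
    have h1 := hx i trivial
    rw [Pi.sub_apply, Real.norm_eq_abs, abs_of_nonneg (by linarith [h1.1])]
    linarith [h1.2]
  have hle : ∀ k : Fin d → ℤ, (if 6 ≤ ‖k‖ then ENNReal.ofReal (g (‖k‖ - 3)) else 0) ≤
      ∫⁻ x in T k, ENNReal.ofReal (f ‖x‖) := fun k => by
    split_ifs with hk
    · calc ENNReal.ofReal (g (‖k‖ - 3)) = ∫⁻ _ in T k, ENNReal.ofReal (g (‖k‖ - 3)) := by
            rw [setLIntegral_const, hvol, mul_one]
        _ ≤ _ := setLIntegral_mono' (hT k) fun x hx => by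
            have h1 := abs_le.1 (hnorm k x hx)
            have h2 : ‖x‖ ∈ Ici (5 : ℝ) := by rw [mem_Ici]; linarith [h1.1]
            rw [hf, indicator_of_mem h2]
            refine ENNReal.ofReal_le_ofReal (hg ?_ ?_ ?_)
            · rw [mem_Ici] at h2 ⊢; linarith
            · rw [mem_Ici]; linarith
            · linarith [h1.2]
    · exact zero_le
  calc _ ≤ ∑' k, ∫⁻ x in T k, ENNReal.ofReal (f ‖x‖) := ENNReal.tsum_le_tsum hle
    _ = ∫⁻ x in ⋃ k, T k, ENNReal.ofReal (f ‖x‖) :=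
        (lintegral_iUnion hT (fun _ _ h => hdisj h) _).symm
    _ ≤ ∫⁻ x, ENNReal.ofReal (f ‖x‖) := setLIntegral_le_lintegral _ _
    _ < ∞ := hfint.lintegral_lt_top

/-- The error allotted to a cube is the same for all its Borel subsets, so the total error does not
depend on `B`. -/
theorem measure_le_add_tsum_of_cubes {d : ℕ} (μ ν : Measure (Space d))
    {err : (Fin d → ℤ) → ℝ≥0∞}
    (h : ∀ k B, MeasurableSet B → B ⊆ cubeAt k → μ B ≤ ν B + err k)
    {B : Set (Space d)} (hB : MeasurableSet B) : μ B ≤ ν B + ∑' k, err k := by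
  have hBk : ∀ k : Fin d → ℤ, MeasurableSet (B ∩ cubeAt k) := fun k =>
    hB.inter (measurableSet_cubeAt k)
  have hsplit : ∀ ρ : Measure (Space d), ρ B = ∑' k : Fin d → ℤ, ρ (B ∩ cubeAt k) := fun ρ => by
    rw [← measure_iUnion (fun k l hkl => (pairwise_disjoint_cubeAt d hkl).mono inter_subset_right
      inter_subset_right) hBk, ← inter_iUnion, iUnion_cubeAt, inter_univ]
  rw [hsplit μ, hsplit ν, ← ENNReal.tsum_add]
  exact ENNReal.tsum_le_tsum fun k => h k _ (hBk k) inter_subset_right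

/-! ### Jordan decomposition of a bounded difference. -/

/-- Two locally finite measures whose difference is bounded as a set function have a difference
with finite Jordan decomposition. -/
theorem exists_isJordanDecomposition {d : ℕ} {μ₁ μ₂ : Measure (Space d)}
    (h₁ : ∀ B, Bornology.IsBounded B → μ₁ B < ∞) (h₂ : ∀ B, Bornology.IsBounded B → μ₂ B < ∞)
    {c : ℝ≥0∞} (hc : c ≠ ∞) (h₁₂ : ∀ B, MeasurableSet B → μ₁ B ≤ μ₂ B + c)
    (h₂₁ : ∀ B, MeasurableSet B → μ₂ B ≤ μ₁ B + c) :
    ∃ μp μm : Measure (Space d),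
      IsJordanDecomposition (fun B => (μ₁ B).toReal - (μ₂ B).toReal) μp μm ∧
        (μp + μm) univ < ∞ := by
  have := sigmaFinite_of_bounded_lt_top h₁
  have := sigmaFinite_of_bounded_lt_top h₂
  -- With densities `f`, `g` with respect to the sum, the truncated differences `f - g` and `g - f`
  -- are the two Jordan parts. They are separated by the set where `f ≤ g`.
  set τ := μ₁ + μ₂
  set f := μ₁.rnDeriv τ
  set g := μ₂.rnDeriv τ
  have hf : Measurable f := Measure.measurable_rnDeriv _ _
  have hg : Measurable g := Measure.measurable_rnDeriv _ _
  have hμ₁ : τ.withDensity f = μ₁ :=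
    Measure.withDensity_rnDeriv_eq _ _ (Measure.le_add_right le_rfl).absolutelyContinuous
  have hμ₂ : τ.withDensity g = μ₂ :=
    Measure.withDensity_rnDeriv_eq _ _ (Measure.le_add_left le_rfl).absolutelyContinuous
  have hfB : ∀ B, MeasurableSet B → ∫⁻ x in B, f x ∂τ = μ₁ B := fun B hB => by
    rw [← withDensity_apply _ hB, hμ₁]
  have hgB : ∀ B, MeasurableSet B → ∫⁻ x in B, g x ∂τ = μ₂ B := fun B hB => by
    rw [← withDensity_apply _ hB, hμ₂]
  have hballs : Monotone fun n : ℕ => Metric.closedBall (0 : Space d) n := fun m n h =>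
    Metric.closedBall_subset_closedBall (by exact_mod_cast h)
  have hp : ∫⁻ x, (f x - g x) ∂τ ≤ c :=
    lintegral_sub_le_of_setLIntegral_le_add τ hf hg (fun _ => measurableSet_closedBall) hballs
      (Metric.iUnion_closedBall_nat 0)
      (fun n => by rw [hgB _ measurableSet_closedBall]; exact (h₂ _ Metric.isBounded_closedBall).ne)
      fun s hs _ => by rw [hfB s hs, hgB s hs]; exact h₁₂ s hs
  have hm : ∫⁻ x, (g x - f x) ∂τ ≤ c :=
    lintegral_sub_le_of_setLIntegral_le_add τ hg hf (fun _ => measurableSet_closedBall) hballs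
      (Metric.iUnion_closedBall_nat 0)
      (fun n => by rw [hfB _ measurableSet_closedBall]; exact (h₁ _ Metric.isBounded_closedBall).ne)
      fun s hs _ => by rw [hfB s hs, hgB s hs]; exact h₂₁ s hs
  set μp := τ.withDensity fun x => f x - g x with hμp
  set μm := τ.withDensity fun x => g x - f x with hμm
  have hpt : μp univ ≤ c := by rwa [hμp, withDensity_apply _ .univ, setLIntegral_univ]
  have hmt : μm univ ≤ c := by rwa [hμm, withDensity_apply _ .univ, setLIntegral_univ]
  have hpB : ∀ B, μp B < ∞ := fun B => ((measure_mono (subset_univ B)).trans hpt).trans_lt hc.lt_top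
  have hmB : ∀ B, μm B < ∞ := fun B => ((measure_mono (subset_univ B)).trans hmt).trans_lt hc.lt_top
  refine ⟨μp, μm, ⟨?_, fun B _ => hpB B, fun B _ => hmB B, fun B hB hBb => ?_⟩, ?_⟩
  · have hH : MeasurableSet {x | f x ≤ g x} := measurableSet_le hf hg
    refine ⟨{x | f x ≤ g x}, hH, ?_, ?_⟩
    · rw [hμp, withDensity_apply _ hH, setLIntegral_congr_fun (g := fun _ => 0) hH
        (fun x hx => tsub_eq_zero_of_le hx), lintegral_zero]
    · rw [hμm, withDensity_apply _ hH.compl, setLIntegral_congr_fun (g := fun _ => 0) hH.compl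
        (fun x hx => tsub_eq_zero_of_le (le_of_lt (lt_of_not_ge hx))), lintegral_zero]
  -- Truncated subtraction is avoided by adding: `f + (g - f)` and `g + (f - g)` are both `max f g`.
  · have hadd : μ₁ B + μm B = μ₂ B + μp B := by
      rw [← hfB B hB, ← hgB B hB, hμp, hμm, withDensity_apply _ hB, withDensity_apply _ hB,
        ← lintegral_add_left hf, ← lintegral_add_left hg]
      exact lintegral_congr fun x => by rw [add_tsub_eq_max, add_tsub_eq_max, max_comm]
    have := congrArg ENNReal.toReal hadd
    rw [ENNReal.toReal_add (h₁ B hBb).ne (hmB B).ne, ENNReal.toReal_add (h₂ B hBb).ne (hpB B).ne]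
      at this
    linarith
  · rw [Measure.add_apply]
    exact ENNReal.add_lt_top.2 ⟨hpB _, hmB _⟩

theorem ofReal_abs_toReal_sub {a b : ℝ≥0∞} (ha : a ≠ ∞) (hb : b ≠ ∞) :
    ENNReal.ofReal |a.toReal - b.toReal| = (a - b) + (b - a) := by
  rcases le_total a b with h | h
  · rw [tsub_eq_zero_of_le h, zero_add, abs_sub_comm, ← ENNReal.toReal_sub_of_le h hb,
      abs_of_nonneg ENNReal.toReal_nonneg, ENNReal.ofReal_toReal (by finiteness)]
  · rw [tsub_eq_zero_of_le h, add_zero, ← ENNReal.toReal_sub_of_le h ha,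
      abs_of_nonneg ENNReal.toReal_nonneg, ENNReal.ofReal_toReal (by finiteness)]

/-! ### The uniform bound on the covariance of marked pairs. -/

section Main

variable {d : ℕ} {M : Type*} [MeasurableSpace M] {Ω : Type*} [MeasurableSpace Ω] {P : Measure Ω}
  {X : Ω → Measure (Space d × M)}

/-- The covariance measure of marked pairs is bounded as a set function of the displacement. -/
theorem exists_reducedPairs_bound (hd : 1 ≤ d) [MeasurableEq M] [MeasurableSingletonClass M]
    [IsProbabilityMeasure P] (hX : IsMarkedPointProcess X) (hstat : IsStationary P X)
    [IsFiniteMeasure (cubeMarks P X)]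
    (hΛ : firstMoment P X = volume.prod (cubeMarks P X))
    {βs : ℝ → ℝ} (hβ : IsBetaRate P X βs) {δ : ℝ} (hδ : 0 < δ)
    (hmom : ∀ B : Set (Space d), Bornology.IsBounded B →
      ∫⁻ ω, (X ω (B ×ˢ univ)) ^ (2 + δ) ∂P < ∞)
    (hfin : ∀ B : Set (Space d), Bornology.IsBounded B → ∫⁻ ω, (X ω (B ×ˢ univ)) ^ (2 : ℝ) ∂P < ∞)
    (hint : IntegrableOn (fun r : ℝ => r ^ (d - 1) * (βs r) ^ (δ / (2 + δ))) (Ici 1))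
    {C₁ C₂ : Set M} (hC₁ : MeasurableSet C₁) (hC₂ : MeasurableSet C₂) :
    ∃ c : ℝ≥0∞, c ≠ ∞ ∧ ∀ B : Set (Space d), MeasurableSet B →
      reducedPairs P X (B ×ˢ (C₁ ×ˢ C₂)) ≤ cubeMarks P X C₁ * cubeMarks P X C₂ * volume B + c ∧
      cubeMarks P X C₁ * cubeMarks P X C₂ * volume B ≤ reducedPairs P X (B ×ˢ (C₁ ×ˢ C₂)) + c := by
  -- The choice makes `2 * p = 2 + δ`, the available moment, and `1 / q = δ / (2 + δ)`, the power in
  -- the mixing integral.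
  set p : ℝ := (2 + δ) / 2 with hp
  set q : ℝ := (2 + δ) / δ with hq
  have hpq : p.HolderConjugate q := by
    rw [Real.holderConjugate_iff]
    refine ⟨by rw [hp]; linarith, ?_⟩
    rw [hp, hq]
    field_simp
  have h2p : 2 * p = 2 + δ := by rw [hp]; ring
  have hqe : 1 / q = δ / (2 + δ) := by rw [hq, one_div_div]
  have he : 0 ≤ δ / (2 + δ) := by positivity
  set m := ∫⁻ ω, X ω (unitCube d ×ˢ univ) ^ (2 * p) ∂P +
      ∫⁻ ω, X ω (doubleCubeAt 0 ×ˢ univ) ^ (2 * p) ∂P with hm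
  have hm_top : m ≠ ∞ := by
    rw [hm, h2p]
    exact (ENNReal.add_lt_top.2 ⟨hmom _ (isBounded_unitCube d), hmom _ isBounded_doubleCubeAt_zero⟩).ne
  set θ := cubeMarks P X C₁ * cubeMarks P X C₂
  have hθ : θ ≠ ∞ := ENNReal.mul_ne_top (measure_ne_top _ _) (measure_ne_top _ _)
  set κ := ((reducedPairs P X).restrict (univ ×ˢ (C₁ ×ˢ C₂))).map Prod.fst
  have hκ : ∀ A, MeasurableSet A → κ A = reducedPairs P X (A ×ˢ (C₁ ×ˢ C₂)) := fun A hA => by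
    rw [Measure.map_apply measurable_fst hA, Measure.restrict_apply (measurable_fst hA)]
    congr 1
    ext z; simp
  have hκcube : ∀ k : Fin d → ℤ, κ (cubeAt k) < ∞ := fun k =>
    (Measure.map_mono Measure.restrict_le_self measurable_fst _).trans_lt
      (reducedPairsGround_lt_top hX hfin (isBounded_cubeAt k))
  set K : ℝ≥0∞ := m ^ (1 / p) * 2 ^ (1 / q)
  have hK : K ≠ ∞ := ENNReal.mul_ne_top (ENNReal.rpow_ne_top_of_nonneg hpq.one_div_nonneg hm_top)
    (ENNReal.rpow_ne_top_of_nonneg hpq.symm.one_div_nonneg (by simp))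
  -- Far cubes use mixing with gap `b = ‖k‖ - 3`. On the finitely many near cubes no cancellation is
  -- needed, and the error is the full mass of both measures.
  set far : (Fin d → ℤ) → ℝ≥0∞ := fun k =>
    if 6 ≤ ‖k‖ then ENNReal.ofReal ((βs (‖k‖ - 3)) ^ (δ / (2 + δ))) else 0
  set near : (Fin d → ℤ) → ℝ≥0∞ := fun k => if ‖k‖ < 6 then κ (cubeAt k) + θ else 0
  set err : (Fin d → ℤ) → ℝ≥0∞ := fun k => K * far k + near k
  have hfar : ∑' k, far k < ∞ := by
    refine tsum_lattice_lt_top hd (g := fun r => (βs r) ^ (δ / (2 + δ))) ?_ hint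
    intro r hr s hs hrs
    rw [mem_Ici] at hr hs
    exact Real.rpow_le_rpow (hβ.nonneg s (by linarith)) (hβ.antitone
      (mem_Ici.2 (by linarith)) (mem_Ici.2 (by linarith)) hrs) he
  have hnear : ∑' k, near k < ∞ := by
    have hfinset : {k : Fin d → ℤ | ‖k‖ < 6}.Finite :=
      (isCompact_closedBall (0 : Fin d → ℤ) 6).finite_of_discrete.subset fun k hk =>
        mem_closedBall_zero_iff.2 (le_of_lt hk)
    rw [tsum_eq_sum (s := hfinset.toFinset) fun k hk => if_neg fun h => hk (by simpa using h)]
    refine ENNReal.sum_lt_top.2 fun k _ => ?_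
    split_ifs
    · exact ENNReal.add_lt_top.2 ⟨hκcube k, hθ.lt_top⟩
    · simp
  have herr : ∑' k, err k ≠ ∞ := by
    rw [ENNReal.tsum_add, ENNReal.tsum_mul_left]
    exact (ENNReal.add_lt_top.2 ⟨ENNReal.mul_lt_top hK.lt_top hfar, hnear⟩).ne
  have hcube : ∀ k B, MeasurableSet B → B ⊆ cubeAt k →
      κ B ≤ (θ • volume) B + err k ∧ (θ • volume) B ≤ κ B + err k := fun k B hB hBk => by
    by_cases hk : 6 ≤ ‖k‖
    · have h := reducedPairs_mixing hX hstat hΛ hβ (b := ‖k‖ - 3) (by linarith) (k := k)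
        (by simpa using exists_norm_eq_abs (by linarith : 0 < ‖k‖)) hpq hm.ge hC₁ hC₂ hB hBk
      have hE : m ^ (1 / p) * (2 * ENNReal.ofReal (βs (‖k‖ - 3))) ^ (1 / q) = err k := by
        simp only [err, far, near, if_pos hk, if_neg (not_lt.2 hk), add_zero, K]
        rw [ENNReal.mul_rpow_of_nonneg _ _ hpq.symm.one_div_nonneg, hqe,
          ENNReal.ofReal_rpow_of_nonneg (hβ.nonneg _ (by linarith)) he, mul_assoc]
      rw [hE] at h
      rw [hκ B hB]
      exact h
    · have hE : err k = κ (cubeAt k) + θ := by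
        simp only [err, far, near, if_neg hk, if_pos (not_le.1 hk), mul_zero, zero_add]
      rw [hE]
      constructor
      · calc κ B ≤ κ (cubeAt k) := measure_mono hBk
          _ ≤ κ (cubeAt k) + θ := le_self_add
          _ ≤ _ := le_add_self
      · calc (θ • volume) B ≤ (θ • volume) (cubeAt k) := measure_mono hBk
          _ = θ := by rw [Measure.smul_apply, volume_cubeAt, smul_eq_mul, mul_one]
          _ ≤ κ (cubeAt k) + θ := le_add_self
          _ ≤ _ := le_add_self
  refine ⟨∑' k, err k, herr, fun B hB => ?_⟩
  have h1 := measure_le_add_tsum_of_cubes κ (θ • volume) (fun k B hB hBk => (hcube k B hB hBk).1) hB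
  have h2 := measure_le_add_tsum_of_cubes (θ • volume) κ (fun k B hB hBk => (hcube k B hB hBk).2) hB
  rw [hκ B hB] at h1 h2
  exact ⟨h1, h2⟩

end Main

end MPP

/-! ### Conclusion. -/

theorem mainTheorem3 {d : ℕ} (hd : 1 ≤ d)
    {M : Type*} [TopologicalSpace M] [PolishSpace M] [MeasurableSpace M] [BorelSpace M]
    {Ω : Type*} [MeasurableSpace Ω] (P : Measure Ω) [IsProbabilityMeasure P]
    (X : Ω → Measure (MPP.Space d × M)) (hX : MPP.IsMarkedPointProcess X)
    (hstat : MPP.IsStationary P X) (hpos : 0 < MPP.intensity P X)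
    (βs : ℝ → ℝ) (hβ : MPP.IsBetaRate P X βs)
    (δ : ℝ) (hδ : 0 < δ)
    (hmom : ∫⁻ ω, (X ω (MPP.closedUnitCube d ×ˢ univ)) ^ (2 + δ) ∂P < ∞)
    (hint : IntegrableOn (fun r : ℝ => r ^ (d - 1) * (βs r) ^ (δ / (2 + δ))) (Ici 1)) :
    (∃! ν : Measure (MPP.Space d), MPP.IsReducedFactorialMoment₂ P X ν) ∧
    (∃ Q : Kernel (MPP.Space d × MPP.Space d) (M × M), MPP.IsTwoPointPalmMark P X Q) ∧
    ∀ ν : Measure (MPP.Space d), MPP.IsReducedFactorialMoment₂ P X ν →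
      (∃ μp μm : Measure (MPP.Space d),
        MPP.IsJordanDecomposition (MPP.reducedCovariance P X ν) μp μm ∧ (μp + μm) univ < ∞) ∧
      ∀ Q : Kernel (MPP.Space d × MPP.Space d) (M × M), MPP.IsTwoPointPalmMark P X Q →
        ∀ C₁ C₂ : Set M, MeasurableSet C₁ → MeasurableSet C₂ →
          ∫⁻ x, ENNReal.ofReal |(Q (0, x) (C₁ ×ˢ C₂)).toReal -
            (MPP.palmMark P X C₁).toReal * (MPP.palmMark P X C₂).toReal| ∂ν < ∞ := by
  have hmomB : ∀ B : Set (MPP.Space d), Bornology.IsBounded B →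
      ∫⁻ ω, (X ω (B ×ˢ univ)) ^ (2 + δ) ∂P < ∞ := fun B hB =>
    hstat.lintegral_rpow_lt_top hX (by linarith) hmom hB
  -- Lower moments follow from `t^r ≤ 1 + t^(2+δ)` under a probability measure.
  have hle : ∀ {r : ℝ}, 0 ≤ r → r ≤ 2 + δ → ∀ B : Set (MPP.Space d), Bornology.IsBounded B →
      ∫⁻ ω, (X ω (B ×ˢ univ)) ^ r ∂P < ∞ := fun {r} hr0 hr B hB => by
    refine (lintegral_mono (g := fun ω => 1 + (X ω (B ×ˢ univ)) ^ (2 + δ)) fun ω => ?_).trans_lt ?_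
    · rcases le_total (X ω (B ×ˢ univ)) 1 with h | h
      · exact le_add_right (ENNReal.rpow_le_one h hr0)
      · exact le_add_left (ENNReal.rpow_le_rpow_of_exponent_le h hr)
    · rw [lintegral_add_left measurable_const]
      simpa using hmomB B hB
  have hfin := hle (r := 2) (by norm_num) (by linarith)
  have hfin1 : ∀ B : Set (MPP.Space d), Bornology.IsBounded B → ∫⁻ ω, X ω (B ×ˢ univ) ∂P < ∞ := by
    simpa using hle (r := 1) zero_le_one (by linarith)
  obtain ⟨hθfin, hΛ⟩ := MPP.firstMoment_eq_prod hstat hX hfin1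
  set l := MPP.intensity P X with hl
  have hlθ : l = MPP.cubeMarks P X univ := MPP.intensity_eq_cubeMarks hX
  have hltop : l ≠ ∞ := by rw [hlθ]; exact measure_ne_top _ _
  have hl0 : l ≠ 0 := hpos.ne'
  -- A Markov kernel into `M × M` requires a mark to exist; positive intensity guarantees one.
  have hMne : Nonempty M := by
    by_contra h
    rw [not_nonempty_iff] at h
    exact hl0 (by rw [hlθ, eq_empty_of_isEmpty (univ : Set M), measure_empty])
  have hdiv : ∀ {a b c : ℝ≥0∞}, l * a ≤ l * b + c → a ≤ b + l⁻¹ * c := fun {a b c} h => by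
    have h1 : l⁻¹ * (l * a) ≤ l⁻¹ * (l * b + c) := by gcongr
    rwa [mul_add, ← mul_assoc, ← mul_assoc, ENNReal.inv_mul_cancel hl0 hltop, one_mul, one_mul] at h1
  refine ⟨MPP.existsUnique_isReducedFactorialMoment₂ hstat hX hfin hpos hltop,
    MPP.exists_isTwoPointPalmMark hstat hX hfin, fun ν hν => ?_⟩
  have hνG := (MPP.isReducedFactorialMoment₂_iff hstat hX hfin hpos hltop ν).1 hν
  have hνGB : ∀ B, l * ν B = MPP.reducedPairsGround P X B := fun B => by rw [← hνG]; rfl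
  have hνB : ∀ B, Bornology.IsBounded B → ν B < ∞ := fun B hB => by
    have h1 := MPP.reducedPairsGround_lt_top hX hfin hB
    rw [← hνGB] at h1
    exact lt_top_iff_ne_top.2 fun h2 => by simp [h2, ENNReal.mul_top hl0] at h1
  obtain ⟨c, hc, hcB⟩ := MPP.exists_reducedPairs_bound hd hX hstat hΛ hβ hδ hmomB hfin hint
    (MeasurableSet.univ (α := M)) (MeasurableSet.univ (α := M))
  have hground : ∀ B, MeasurableSet B → MPP.reducedPairs P X (B ×ˢ (univ ×ˢ univ)) = l * ν B :=
    fun B hB => by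
      rw [hνGB, MPP.reducedPairsGround, Measure.map_apply measurable_fst hB, univ_prod_univ, prod_univ]
  have hub : ∀ B, MeasurableSet B → l * ν B ≤ l * (l * volume B) + c := fun B hB => by
    have := (hcB B hB).1
    rwa [hground B hB, ← hlθ, mul_assoc] at this
  have hlb : ∀ B, MeasurableSet B → l * (l * volume B) ≤ l * ν B + c := fun B hB => by
    have := (hcB B hB).2
    rwa [hground B hB, ← hlθ, mul_assoc] at this
  have hlinv : l⁻¹ ≠ ∞ := ENNReal.inv_ne_top.2 hl0
  constructor
  · obtain ⟨μp, μm, hJ, hfinJ⟩ := MPP.exists_isJordanDecomposition (μ₁ := ν)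
      (μ₂ := l • (volume : Measure (MPP.Space d))) (c := l⁻¹ * c) hνB
      (fun B hB => ENNReal.mul_lt_top hltop.lt_top hB.measure_lt_top)
      (ENNReal.mul_ne_top hlinv hc) (fun B hB => hdiv (hub B hB)) (fun B hB => hdiv (hlb B hB))
    refine ⟨μp, μm, ⟨hJ.singular, hJ.finite_pos, hJ.finite_neg, fun B hB hBb => ?_⟩, hfinJ⟩
    rw [← hJ.eq_sub B hB hBb, MPP.reducedCovariance, Measure.smul_apply, smul_eq_mul,
      ENNReal.toReal_mul]
  · intro Q hQ C₁ C₂ hC₁ hC₂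
    have := hQ.markov
    have hC := hC₁.prod hC₂
    obtain ⟨e, he, heB⟩ := MPP.exists_reducedPairs_bound hd hX hstat hΛ hβ hδ hmomB hfin hint hC₁ hC₂
    set π := MPP.palmMark P X C₁ * MPP.palmMark P X C₂ with hπ
    have hθ : MPP.cubeMarks P X C₁ * MPP.cubeMarks P X C₂ = π * l * l := by
      rw [hπ, MPP.palmMark_eq_cubeMarks hX hC₁, MPP.palmMark_eq_cubeMarks hX hC₂, ← hl]
      calc _ = (l⁻¹ * l) * (l⁻¹ * l) * (MPP.cubeMarks P X C₁ * MPP.cubeMarks P X C₂) := by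
            rw [ENNReal.inv_mul_cancel hl0 hltop]; ring
        _ = _ := by ring
    have hπtop : π ≠ ∞ := by
      rw [hπ, MPP.palmMark_eq_cubeMarks hX hC₁, MPP.palmMark_eq_cubeMarks hX hC₂, ← hl]
      exact ENNReal.mul_ne_top (ENNReal.mul_ne_top hlinv (measure_ne_top _ _))
        (ENNReal.mul_ne_top hlinv (measure_ne_top _ _))
    set f : MPP.Space d → ℝ≥0∞ := fun x => Q (0, x) (C₁ ×ˢ C₂) with hf
    have hfm : Measurable f := (Kernel.measurable_coe Q hC).comp measurable_prodMk_left
    have hfB : ∀ B, MeasurableSet B →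
        l * ∫⁻ x in B, f x ∂ν = MPP.reducedPairs P X (B ×ˢ (C₁ ×ˢ C₂)) := fun B hB => by
      rw [hQ.reducedPairs_eq hstat hX hfin hC₁ hC₂ hB, ← hνG, Measure.restrict_smul,
        lintegral_smul_measure]
      rfl
    -- The estimate for `C₁`, `C₂` compares `λ ∫_B f dν` with `π λ² |B|` up to `e`, and the ground
    -- estimate compares `λ² |B|` with `λ ν(B)` up to `c`. Chaining them eliminates Lebesgue
    -- measure.
    set c' := l⁻¹ * (π * c + e)
    have hc' : c' ≠ ∞ := ENNReal.mul_ne_top hlinv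
      (ENNReal.add_ne_top.2 ⟨ENNReal.mul_ne_top hπtop hc, he⟩)
    have h1 : ∀ B, MeasurableSet B → ∫⁻ x in B, f x ∂ν ≤ ∫⁻ _ in B, π ∂ν + c' := fun B hB => by
      rw [setLIntegral_const]
      refine hdiv ?_
      rw [hfB B hB]
      calc _ ≤ π * (l * (l * volume B)) + e := by
            refine (heB B hB).1.trans_eq ?_
            rw [hθ]; ring
        _ ≤ π * (l * ν B + c) + e := by gcongr; exact hlb B hB
        _ = _ := by ring
    have h2 : ∀ B, MeasurableSet B → ∫⁻ _ in B, π ∂ν ≤ ∫⁻ x in B, f x ∂ν + c' := fun B hB => by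
      rw [setLIntegral_const]
      refine hdiv ?_
      rw [hfB B hB]
      calc l * (π * ν B) = π * (l * ν B) := by ring
        _ ≤ π * (l * (l * volume B) + c) := by gcongr; exact hub B hB
        _ = MPP.cubeMarks P X C₁ * MPP.cubeMarks P X C₂ * volume B + π * c := by rw [hθ]; ring
        _ ≤ MPP.reducedPairs P X (B ×ˢ (C₁ ×ˢ C₂)) + e + π * c := by gcongr; exact (heB B hB).2
        _ = _ := by ring
    have hballs : Monotone fun n : ℕ => Metric.closedBall (0 : MPP.Space d) n := fun m n h =>
      Metric.closedBall_subset_closedBall (by exact_mod_cast h)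
    have hπn : ∀ n : ℕ, ∫⁻ _ in Metric.closedBall (0 : MPP.Space d) n, π ∂ν ≠ ∞ := fun n => by
      rw [setLIntegral_const]
      exact ENNReal.mul_ne_top hπtop (hνB _ Metric.isBounded_closedBall).ne
    have hfn : ∀ n : ℕ, ∫⁻ x in Metric.closedBall (0 : MPP.Space d) n, f x ∂ν ≠ ∞ := fun n =>
      ne_top_of_le_ne_top (ENNReal.add_ne_top.2 ⟨hπn n, hc'⟩) (h1 _ measurableSet_closedBall)
    -- Since the bounds hold for all Borel sets, they control the positive and the negative part of
    -- `f - π` separately. The two together are the absolute value.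
    have hle1 := MPP.lintegral_sub_le_of_setLIntegral_le_add ν hfm (measurable_const (a := π))
      (fun _ => measurableSet_closedBall) hballs (Metric.iUnion_closedBall_nat 0) hπn
      fun B hB _ => h1 B hB
    have hle2 := MPP.lintegral_sub_le_of_setLIntegral_le_add ν (measurable_const (a := π)) hfm
      (fun _ => measurableSet_closedBall) hballs (Metric.iUnion_closedBall_nat 0) hfn
      fun B hB _ => h2 B hB
    calc _ = ∫⁻ x, ((f x - π) + (π - f x)) ∂ν := by
          refine lintegral_congr fun x => ?_
          rw [← ENNReal.toReal_mul, MPP.ofReal_abs_toReal_sub (measure_ne_top _ _) hπtop]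
      _ = ∫⁻ x, (f x - π) ∂ν + ∫⁻ x, (π - f x) ∂ν :=
          lintegral_add_left (hfm.sub measurable_const) _
      _ ≤ c' + c' := add_le_add hle1 hle2
      _ < ∞ := ENNReal.add_lt_top.2 ⟨hc'.lt_top, hc'.lt_top⟩
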